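/- **Model.** In the congested clique on $n$ nodes, in each synchronous round every node sends to every node a message of $\lceil\log_2 n\rceil$ bits (the messages may differ); local computation is free. All algorithms are deterministic, and a separate algorithm is allowed for each choice of the parameters. For a finite field $\mathbb F$ and integers $n\ge 1$, $m\ge 0$, $k\ge 1$, the problem $\mathsf{MM}(n,m,k,\mathbb F)$ is: given $A_1,\dots,A_k\in\mathbb F^{n\times m}$ and $B_1,\dots,B_k\in\mathbb F^{m\times n}$, where node $\ell$ initially holds the $\ell$-th row of each $A_s$ and the $\ell$-th column of each $B_s$, compute the products so that node $\ell$ ends up with the $\ell$-th row and the $\ell$-th column of each $A_sB_s$. **Exponent.** Let $\mathcal F$ be a non-empty family of finite fields (for instance a single field) and let $p$ be a polynomial with coefficients in $\mathbb N$. An algebraic algorithm of rank $t$ over $\mathbb F$ for the product of an $n\times m$ matrix $A$ by an $m\times n$ matrix $B$ consists of coefficients $\alpha_{ij\mu},\beta_{ij\mu},\lambda_{ij\mu}\in\mathbb F$ such that, for all $A,B$ and all $i,j$, $(AB)[i,j]=\sum_{\mu=1}^t\lambda_{ij\mu}\bigl(\sum_{i',j'}\alpha_{i'j'\mu}A[i',j']\bigr)\bigl(\sum_{i',j'}\beta_{i'j'\mu}B[j',i']\bigr)$.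 For $\gamma\ge0$ let $\omega(\gamma)$ be the least $\tau$ such that for every $\varepsilon>0$ the product of an $n\times\lceil n^\gamma\rceil$ matrix by an $\lceil n^\gamma\rceil\times n$ matrix has, over every $\mathbb F\in\mathcal F$ and for every $n\ge1$, an algebraic algorithm of rank $O(n^{\tau+\varepsilon})$, with a constant independent of $n$ and $\mathbb F$. (For a single field this is the usual exponent.) Put $\omega=\omega(1)$. **Theorem.** The following bounds hold for all $\mathbb F\in\mathcal F$ and all $n,m,k$ in the stated ranges such that $|\mathbb F|\le p(n)$; the implied constants depend only on $\mathcal F$, $p$ and, where it appears, $\varepsilon$. For $1\le k\le n$, the deterministic round complexity of $\mathsf{MM}(n,m,k,\mathbb F)$ is * $O(k)$ if $0\le m\le\sqrt{kn}$; * $O\bigl(k^{2/\omega(\gamma)}n^{1-2/\omega(\gamma)}(n/k)^{\varepsilon}\bigr)$ for every $\varepsilon>0$ if $\sqrt{kn}\le m<n^2/k$, where $\gamma\ge 0$ is the solution of $$\Bigl(1-\frac{\log k}{\log n}\Bigr)\gamma=1-\frac{\log k}{\log n}+\Bigl(\frac{\log m}{\log n}-1\Bigr)\omega(\gamma),$$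 which exists and is unique (for all such $n,m,k$, irrespective of $p$); * $O(km/n)$ if $m\ge n^2/k$. For $k\ge n\ge 1$, it is $O(k)$ if $1\le m\le n$, and $O(km/n)$ if $m\ge n$. In particular, for square matrices ($m=n$) it is $O\bigl(k^{2/\omega}n^{1-2/\omega}(n/k)^{\varepsilon}\bigr)$ for every $\varepsilon>0$ if $1\le k<n$, and $O(k)$ if $k\ge n$. -/

import Mathlib

open scoped BigOperators

universe u

/-- A message of the congested clique on `n` nodes: a string of `⌈log₂ n⌉` bits. -/
abbrev CliqueMessage (n : ℕ) : Type := Fin (Nat.clog 2 n) → Bool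

/-- A deterministic protocol in the congested clique on the `n` nodes `Fin n`. Every node starts with
an element of `Inp` as its local input. In each synchronous round every node sends one message (possibly
a different one) to every node, and updates its local state with the messages it received.
Local computation is unrestricted. -/
structure CliqueProtocol (n : ℕ) (Inp Out : Type u) where
  /-- the type of local states -/
  State : Type u
  /-- the initial state of a node, as a function of its own input only -/
  init : Fin n → Inp → State
  /-- `send t v s w` is the message sent to `w` in round `t` by the node `v` being in state `s` -/
  send : ℕ → Fin n → State → Fin n → CliqueMessage n
  /-- `receive t v s f` is the state after round `t` of the node `v`, being in state `s` before the
  round and receiving the message `f w` from each node `w` -/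
  receive : ℕ → Fin n → State → (Fin n → CliqueMessage n) → State
  /-- the output of a node, as a function of its own final state only -/
  output : Fin n → State → Out

/-- The local states of the nodes after a given number of rounds, on the distributed input `x`. -/
def CliqueProtocol.run {n : ℕ} {Inp Out : Type u} (P : CliqueProtocol n Inp Out) (x : Fin n → Inp) :
    ℕ → Fin n → P.State
  | 0, v => P.init v (x v)
  | t + 1, v => P.receive t v (P.run x t v) (fun w => P.send t w (P.run x t w) v)

/-- The problem `MM(n, m, k, F)` can be solved deterministically in `T` rounds: some protocol computes,
for all `A₁, …, A_k ∈ F^{n×m}` and `B₁, …, B_k ∈ F^{m×n}`, the products `A_s B_s`, where node `ℓ` initially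
has the `ℓ`-th row of each `A_s` and the `ℓ`-th column of each `B_s`, and after `T` rounds has the `ℓ`-th
row and the `ℓ`-th column of each `A_s B_s`. -/
def SolvableMM (n m k : ℕ) (F : Type u) [Field F] (T : ℕ) : Prop :=
  ∃ P : CliqueProtocol n ((Fin k → Fin m → F) × (Fin k → Fin m → F))
      ((Fin k → Fin n → F) × (Fin k → Fin n → F)),
    ∀ (A : Fin k → Matrix (Fin n) (Fin m) F) (B : Fin k → Matrix (Fin m) (Fin n) F) (l : Fin n),
      P.output l (P.run (fun v => (fun s j => A s v j, fun s j => B s j v)) T l) =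
        (fun s j => (A s * B s) l j, fun s i => (A s * B s) i l)

/-- The deterministic round complexity of `MM(n, m, k, F)` is at most the real number `R`. -/
def RoundsMMLe (n m k : ℕ) (F : Type u) [Field F] (R : ℝ) : Prop :=
  ∃ T : ℕ, SolvableMM n m k F T ∧ (T : ℝ) ≤ R

/-- There is an algebraic (bilinear) algorithm of rank `t` for the product of an `n × m` matrix by an
`m × n` matrix over `F`. -/
def HasAlgebraicAlgorithm (F : Type*) [Field F] (n m t : ℕ) : Prop :=
  ∃ (α β : Fin n → Fin m → Fin t → F) (lam : Fin n → Fin n → Fin t → F),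
    ∀ (A : Matrix (Fin n) (Fin m) F) (B : Matrix (Fin m) (Fin n) F) (i j : Fin n),
      (A * B) i j = ∑ μ : Fin t, lam i j μ *
        (∑ i' : Fin n, ∑ j' : Fin m, α i' j' μ * A i' j') *
        (∑ i' : Fin n, ∑ j' : Fin m, β i' j' μ * B j' i')

/-- The exponent `ω(γ)` of the product of an `n × ⌈n^γ⌉` matrix by an `⌈n^γ⌉ × n` matrix over the fields
`F i`: the least `τ` such that rank `O(n^{τ+ε})` suffices for every `ε > 0`, with an implied constant that
is the same for all `i`. For a single field this is the usual exponent over that field. -/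
noncomputable def matMulExponent {ι : Type*} (F : ι → Type*) [∀ i, Field (F i)] (γ : ℝ) : ℝ :=
  sInf {τ : ℝ | ∀ ε : ℝ, 0 < ε → ∃ C : ℝ, ∀ (i : ι) (n : ℕ), 1 ≤ n →
    ∃ t : ℕ, HasAlgebraicAlgorithm (F i) n ⌈(n : ℝ) ^ γ⌉₊ t ∧ (t : ℝ) ≤ C * (n : ℝ) ^ (τ + ε)}

/-- The equation
`(1 - log k / log n) γ = 1 - log k / log n + (log m / log n - 1) ω(γ)` for `γ ≥ 0`. -/
def IsBalancedExponent {ι : Type*} (F : ι → Type*) [∀ i, Field (F i)] (n m k : ℕ) (γ : ℝ) : Prop :=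
  0 ≤ γ ∧
    (1 - Real.log k / Real.log n) * γ =
      1 - Real.log k / Real.log n + (Real.log m / Real.log n - 1) * matMulExponent F γ

/-! Everything comes from one scheme, block multiplication driven by a bilinear algorithm of rank
`t` for the shape `d × e` by `e × d`. Each `A_s` is viewed as a `d × e` matrix whose entries are
blocks of size about `n/d × m/e`, and similarly for `B_s`; the algorithm then reduces `A_s B_s` to
`t` products of blocks. Linear combinations act entrywise on blocks, so the node in charge of one
position inside the blocks computes that entry of all `t` combinations. Other nodes multiply whole
blocks, and the output combinations are again formed position by position. Between these local steps
the data move along patterns fixed in advance, and such a pattern with at most `D * n` field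
elements sent and received per node takes `O(D)` rounds. Counting loads gives `O((kt/n + 1)(m/(de) +
n/d² + 1) + k + km/n)` rounds (`roundsMMLe_of_algorithm`).

The ranges of the theorem are choices of `(d, e, t)`, with `kt ≤ n` whenever `k ≤ n`. For `m ≤
√(kn)`, outer products with `d² ≈ n/k`, `e = 1` suffice; for `m ≥ n²/k`, inner products with `d =
1`, `e ≈ n/k`; for `k ≥ n`, `d = e = t = 1`. In between, `d ≈ (n/k)^{1/ω(γ)}` and `e ≈ d^γ`, so `t ≈
d^{ω(γ)}` is about `n/k`. The equation for `γ` says exactly that `m/(de)` and `n/d²` are then of the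
same order, namely `k^{2/ω(γ)} n^{1-2/ω(γ)}`.

The equation is uniquely solvable because `ω(0) = 2` and `ω` is nondecreasing and 1-Lipschitz
(`existsUnique_balanced`). As `γ` varies with `n, m, k`, the rank constants must be uniform in `γ`;
the Lipschitz property reduces this to finitely many exponents (`exists_uniform_rank_bound`). -/

/-! ### Composition of protocols and direct exchange -/

/-- Some protocol on `n` nodes computes the distributed function `R` in `T` rounds. -/
def CliqueComputes {n : ℕ} {Inp Out : Type u} (T : ℕ) (R : (Fin n → Inp) → Fin n → Out) : Prop :=
  ∃ P : CliqueProtocol n Inp Out, ∀ x l, P.output l (P.run x T l) = R x l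

/-- Run the first protocol for `T` rounds, then the second one on its outputs. -/
def CliqueProtocol.comp {n : ℕ} {Inp Mid Out : Type u} (P : CliqueProtocol n Inp Mid) (T : ℕ)
    (Q : CliqueProtocol n Mid Out) : CliqueProtocol n Inp Out where
  State := P.State ⊕ Q.State
  init v a := Sum.inl (P.init v a)
  send t v s w :=
    if t < T then Sum.elim (fun a => P.send t v a w) (fun _ _ => false) s
    else Q.send (t - T) v (Sum.elim (fun a => Q.init v (P.output v a)) id s) w
  receive t v s f :=
    if t < T then Sum.elim (fun a => Sum.inl (P.receive t v a f)) Sum.inr s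
    else Sum.inr (Q.receive (t - T) v (Sum.elim (fun a => Q.init v (P.output v a)) id s) f)
  output v s := Q.output v (Sum.elim (fun a => Q.init v (P.output v a)) id s)

theorem CliqueProtocol.comp_run_of_le {n : ℕ} {Inp Mid Out : Type u} (P : CliqueProtocol n Inp Mid)
    (T : ℕ) (Q : CliqueProtocol n Mid Out) (x : Fin n → Inp) :
    ∀ t ≤ T, ∀ v, (P.comp T Q).run x t v = Sum.inl (P.run x t v) := by
  intro t
  induction t with
  | zero => intro _ v; rfl
  | succ t ih =>
    intro ht v
    have ih' := ih (by omega)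
    have htT : t < T := by omega
    simp only [CliqueProtocol.run, ih']
    simp [CliqueProtocol.comp, htT]

/-- The switch is lazy: after round `T` the state is still a final state of `P`, and it is turned
into an initial state of `Q` only when next used. Hence the comparison goes through `Sum.elim`. -/
theorem CliqueProtocol.comp_run_add {n : ℕ} {Inp Mid Out : Type u} (P : CliqueProtocol n Inp Mid)
    (T : ℕ) (Q : CliqueProtocol n Mid Out) (x : Fin n → Inp) :
    ∀ t v, Sum.elim (fun a => Q.init v (P.output v a)) id ((P.comp T Q).run x (T + t) v) =
      Q.run (fun l => P.output l (P.run x T l)) t v := by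
  intro t
  induction t with
  | zero =>
    intro v
    rw [Nat.add_zero, CliqueProtocol.comp_run_of_le P T Q x T le_rfl v]
    rfl
  | succ t ih =>
    intro v
    have h : ¬ (T + t < T) := by omega
    rw [← Nat.add_assoc]
    simp only [CliqueProtocol.run, ← ih]
    simp [CliqueProtocol.comp, h]

theorem CliqueComputes.comp {n : ℕ} {Inp Mid Out : Type u} {T₁ T₂ : ℕ}
    {R₁ : (Fin n → Inp) → Fin n → Mid} {R₂ : (Fin n → Mid) → Fin n → Out}
    (h₂ : CliqueComputes T₂ R₂) (h₁ : CliqueComputes T₁ R₁) :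
    CliqueComputes (T₁ + T₂) (fun x => R₂ (R₁ x)) := by
  obtain ⟨P, hP⟩ := h₁
  obtain ⟨Q, hQ⟩ := h₂
  refine ⟨P.comp T₁ Q, fun x l => ?_⟩
  have h := CliqueProtocol.comp_run_add P T₁ Q x T₂ l
  have h1 : (fun l => P.output l (P.run x T₁ l)) = R₁ x := funext fun l => hP x l
  rw [h1] at h
  change _ = R₂ (R₁ x) l
  rw [← hQ, ← h]
  rfl

theorem CliqueComputes.local {n : ℕ} {Inp Out : Type u} (f : Fin n → Inp → Out) :
    CliqueComputes 0 (fun x l => f l (x l)) :=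
  ⟨{ State := Inp
     init := fun _ a => a
     send := fun _ _ _ _ _ => false
     receive := fun _ _ s _ => s
     output := f }, fun _ _ => rfl⟩

/-- Every node sends to every node one element of a type whose elements are encoded by `q` messages. -/
theorem CliqueComputes.exchange {n q : ℕ} {Inp Out : Type u} {M : Type*} [Nonempty M]
    (enc : M → Fin q → CliqueMessage n) (henc : Function.Injective enc)
    (snd : Fin n → Inp → Fin n → M) (rcv : Fin n → Inp → (Fin n → M) → Out) :
    CliqueComputes q (fun x l => rcv l (x l) (fun w => snd w (x w) l)) := by
  let P : CliqueProtocol n Inp Out :=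
    { State := Inp × (ℕ → Fin n → CliqueMessage n)
      init := fun _ a => (a, fun _ _ _ => false)
      -- Round `t` carries the `t`-th of the `q` messages of the codeword; received messages are
      -- filed by round and decoded only at the output.
      send := fun t v s w => if h : t < q then enc (snd v s.1 w) ⟨t, h⟩ else fun _ => false
      receive := fun t _ s f => (s.1, Function.update s.2 t f)
      output := fun l s => rcv l s.1 (fun w => Function.invFun enc (fun i => s.2 i w)) }
  have key : ∀ (x : Fin n → Inp) (T : ℕ) (v : Fin n), (P.run x T v).1 = x v ∧
      ∀ t < T, ∀ h : t < q, ∀ w, (P.run x T v).2 t w = enc (snd w (x w) v) ⟨t, h⟩ := by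
    intro x T
    induction T with
    | zero => exact fun v => ⟨rfl, fun t ht => absurd ht (Nat.not_lt_zero _)⟩
    | succ T ih =>
      intro v
      refine ⟨(ih v).1, fun t ht h w => ?_⟩
      change Function.update (P.run x T v).2 T (fun w => P.send T w (P.run x T w) v) t w = _
      by_cases htT : t = T
      · subst htT
        simp [P, h, (ih w).1]
      · rw [Function.update_of_ne htT]
        exact (ih v).2 t (by omega) h w
  refine ⟨P, fun x l => ?_⟩
  change rcv l (P.run x q l).1 (fun w => Function.invFun enc (fun i => (P.run x q l).2 i w)) = _
  rw [(key x q l).1]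
  congr 1
  funext w
  have : (fun i : Fin q => (P.run x q l).2 i w) = enc (snd w (x w) l) :=
    funext fun i => (key x q l).2 i i.2 i.2 w
  rw [this, Function.leftInverse_invFun henc]

/-! ### Oblivious routing -/

/-- Greedy edge colouring of a bipartite multigraph. -/
theorem exists_edge_coloring {E V κ : Type*} [Fintype E] [DecidableEq E] [DecidableEq V] [Fintype κ]
    (src dst : E → V) (L : ℕ)
    (hs : ∀ v, (Finset.univ.filter fun e => src e = v).card ≤ L)
    (hd : ∀ v, (Finset.univ.filter fun e => dst e = v).card ≤ L) (hκ : 2 * L ≤ Fintype.card κ) :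
    ∃ col : E → κ, ∀ e e', col e = col e' → (src e = src e' ∨ dst e = dst e') → e = e' := by
  classical
  have main : ∀ S : Finset E, ∃ col : {e // e ∈ S} → κ, ∀ e e', col e = col e' →
      (src e = src e' ∨ dst e = dst e') → e = e' := by
    intro S
    induction S using Finset.induction_on with
    | empty => exact ⟨fun e => absurd e.2 (Finset.notMem_empty _), fun e => absurd e.2 (Finset.notMem_empty _)⟩
    | insert a S ha ih =>
      obtain ⟨col, hcol⟩ := ih
      -- The edges in conflict with `a` number at most `2 * (L - 1)`, so one of the `2 * L` colours
      -- is free for `a`.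
      let N : Finset E := (Finset.univ.filter fun e => src e = src a).erase a ∪
        (Finset.univ.filter fun e => dst e = dst a).erase a
      have hN : N.card < Fintype.card κ := by
        have h1 : ((Finset.univ.filter fun e => src e = src a).erase a).card + 1 ≤ L := by
          rw [Finset.card_erase_add_one (by simp)]; exact hs _
        have h2 : ((Finset.univ.filter fun e => dst e = dst a).erase a).card + 1 ≤ L := by
          rw [Finset.card_erase_add_one (by simp)]; exact hd _
        have h3 := Finset.card_union_le ((Finset.univ.filter fun e => src e = src a).erase a)
          ((Finset.univ.filter fun e => dst e = dst a).erase a)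
        change (_ ∪ _ : Finset E).card < _
        omega
      let N' : Finset {e // e ∈ S} := N.subtype _
      have hN' : (N'.image col).card < (Finset.univ : Finset κ).card := by
        refine lt_of_le_of_lt Finset.card_image_le (lt_of_le_of_lt ?_ hN)
        rw [Finset.card_subtype]
        exact Finset.card_filter_le _ _
      obtain ⟨c, -, hc⟩ := Finset.exists_mem_notMem_of_card_lt_card hN'
      have hfresh : ∀ e : {e // e ∈ S}, (src e = src a ∨ dst e = dst a) → col e ≠ c := by
        intro e he hce
        apply hc
        rw [Finset.mem_image]
        refine ⟨e, ?_, hce⟩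
        have hne : (e : E) ≠ a := fun h => ha (h ▸ e.2)
        simp only [N', N, Finset.mem_subtype, Finset.mem_union, Finset.mem_erase, Finset.mem_filter,
          Finset.mem_univ, true_and]
        tauto
      refine ⟨fun e => if h : (e : E) ∈ S then col ⟨e, h⟩ else c, ?_⟩
      rintro ⟨e, he⟩ ⟨e', he'⟩ heq hor
      simp only at heq hor
      apply Subtype.ext
      by_cases h : e ∈ S <;> by_cases h' : e' ∈ S
      · simp only [h, h', dif_pos] at heq
        exact congrArg (fun z => z.1) (hcol ⟨e, h⟩ ⟨e', h'⟩ heq hor)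
      · simp only [h, h', dif_pos, dif_neg, not_false_eq_true] at heq
        have : e' = a := (Finset.mem_insert.1 he').resolve_right h'
        subst this
        exact absurd heq (hfresh ⟨e, h⟩ hor)
      · simp only [h, h', dif_pos, dif_neg, not_false_eq_true] at heq
        have : e = a := (Finset.mem_insert.1 he).resolve_right h
        subst this
        exact absurd heq.symm (hfresh ⟨e', h'⟩ (hor.imp Eq.symm Eq.symm))
      · exact ((Finset.mem_insert.1 he).resolve_right h).trans
          ((Finset.mem_insert.1 he').resolve_right h').symm
  obtain ⟨col, hcol⟩ := main Finset.univ
  refine ⟨fun e => col ⟨e, Finset.mem_univ e⟩, fun e e' h h' => ?_⟩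
  exact congrArg Subtype.val (hcol _ _ h h')

/-- Oblivious routing: field elements indexed by `E` travel from `src e` to `dst e`; no node sends or
receives more than `D * n` of them. -/
theorem CliqueComputes.route {n q D : ℕ} {F : Type u} [AddCommMonoid F] {E : Type} [Fintype E]
    (enc : F → Fin q → CliqueMessage n) (henc : Function.Injective enc) (src dst : E → Fin n)
    (hs : ∀ v, (Finset.univ.filter fun e => src e = v).card ≤ D * n)
    (hd : ∀ v, (Finset.univ.filter fun e => dst e = v).card ≤ D * n) :
    CliqueComputes (4 * D * q) (fun (x : Fin n → E → F) l e =>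
      if dst e = l then x (src e) e else 0) := by
  classical
  -- A colour `(r, w)` means: travel through the intermediate node `w`, in slot `r` of the `2 * D`
  -- slots of each link. Properness at sources and at destinations makes each slot carry at most one
  -- element in either phase, so the sums below merely read off that element.
  obtain ⟨col, hcol⟩ := exists_edge_coloring (κ := Fin (2 * D) × Fin n) src dst (D * n) hs hd
    (by simp [mul_assoc])
  let enc' : (Fin (2 * D) → F) → Fin (2 * D * q) → CliqueMessage n := fun m i =>
    enc (m (finProdFinEquiv.symm i).1) (finProdFinEquiv.symm i).2
  have henc' : Function.Injective enc' := by
    intro m m' h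
    funext j
    apply henc
    funext b
    have := congrFun h (finProdFinEquiv (j, b))
    simpa only [enc', Equiv.symm_apply_apply] using this
  have h1 := CliqueComputes.exchange (Inp := E → F) (Out := Fin n → Fin (2 * D) → F) enc' henc'
    (fun v x w r => ∑ e with src e = v ∧ col e = (r, w), x e) (fun _ _ f => f)
  have h2 := CliqueComputes.exchange (Inp := Fin n → Fin (2 * D) → F) (Out := E → F) enc' henc'
    (fun w y u r => ∑ e with dst e = u ∧ col e = (r, w), y (src e) r)
    (fun u _ z e => if dst e = u then z (col e).2 (col e).1 else 0)
  have h := h2.comp h1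
  have hT : 4 * D * q = 2 * D * q + 2 * D * q := by ring
  rw [hT]
  convert h using 1
  funext x l e
  split_ifs with hl
  · dsimp only
    rw [Finset.sum_eq_single e, Finset.sum_eq_single e]
    · intro e' he' hne
      simp only [Finset.mem_filter, Finset.mem_univ, true_and, Prod.mk.eta] at he'
      exact absurd (hcol _ _ he'.2 (Or.inl he'.1)) hne
    · simp
    · intro e' he' hne
      simp only [Finset.mem_filter, Finset.mem_univ, true_and, Prod.mk.eta] at he'
      exact absurd (hcol _ _ he'.2 (Or.inr (he'.1.trans hl.symm))) hne
    · simp [hl]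
  · rfl

/-- Load counting: the packets at `v` are determined by one of the at most `a` objects that `g`
places at `v`, together with a label in `Q`. -/
theorem card_fiber_comp_le {E P Q V : Type*} [Fintype E] [Fintype P] [Fintype Q] [DecidableEq V]
    {f : E → V} (h : E → P) (g : P → V) (ρ : E → Q) (hf : ∀ e, f e = g (h e))
    (hinj : Function.Injective fun e => (h e, ρ e)) {a : ℕ}
    (ha : ∀ v, (Finset.univ.filter fun x => g x = v).card ≤ a) (v : V) :
    (Finset.univ.filter fun e => f e = v).card ≤ a * Fintype.card Q := by
  classical
  calc (Finset.univ.filter fun e => f e = v).card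
      ≤ ((Finset.univ.filter fun x => g x = v) ×ˢ (Finset.univ : Finset Q)).card := by
        refine Finset.card_le_card_of_injOn (fun e => (h e, ρ e)) ?_ hinj.injOn
        intro e he
        simpa [← hf] using he
    _ ≤ a * Fintype.card Q := by
        rw [Finset.card_product, Finset.card_univ]
        exact Nat.mul_le_mul_right _ (ha v)

theorem card_fiber_id_le {V : Type*} [Fintype V] [DecidableEq V] (v : V) :
    (Finset.univ.filter fun x : V => id x = v).card ≤ 1 := by
  simp [Finset.filter_eq']

/-! ### Distributed block multiplication -/

/-- A bilinear algorithm for small matrices, applied to blocks of larger matrices. -/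
theorem mul_apply_of_block_algorithm {F : Type*} [Field F] {n m d e t r c : ℕ}
    {α β : Fin d → Fin e → Fin t → F} {lam : Fin d → Fin d → Fin t → F}
    (h : ∀ (A : Matrix (Fin d) (Fin e) F) (B : Matrix (Fin e) (Fin d) F) (i j : Fin d),
      (A * B) i j = ∑ μ : Fin t, lam i j μ *
        (∑ i' : Fin d, ∑ j' : Fin e, α i' j' μ * A i' j') *
        (∑ i' : Fin d, ∑ j' : Fin e, β i' j' μ * B j' i'))
    (φ : Fin n ↪ Fin d × Fin r) (ψ : Fin m ↪ Fin e × Fin c)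
    (A : Matrix (Fin n) (Fin m) F) (B : Matrix (Fin m) (Fin n) F) (i j : Fin n) :
    (A * B) i j = ∑ μ : Fin t, lam (φ i).1 (φ j).1 μ * ∑ b : Fin c,
      (∑ x : Fin n, ∑ y : Fin m,
        if (φ x).2 = (φ i).2 ∧ (ψ y).2 = b then α (φ x).1 (ψ y).1 μ * A x y else 0) *
      (∑ x : Fin n, ∑ y : Fin m,
        if (φ x).2 = (φ j).2 ∧ (ψ y).2 = b then β (φ x).1 (ψ y).1 μ * B y x else 0) := by
  classical
  -- `φ` and `ψ` split an index into a block number and a position inside the block. `A' b` collects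
  -- the entries of `A` at position `((φ i).2, b)` in all blocks, with zeros where a block is
  -- incomplete; `A * B` at `(i, j)` is then a sum over `b` of small products.
  let A' : Fin c → Matrix (Fin d) (Fin e) F := fun b p s =>
    ∑ x : Fin n, ∑ y : Fin m, if φ x = (p, (φ i).2) ∧ ψ y = (s, b) then A x y else 0
  let B' : Fin c → Matrix (Fin e) (Fin d) F := fun b s p =>
    ∑ x : Fin n, ∑ y : Fin m, if φ x = (p, (φ j).2) ∧ ψ y = (s, b) then B y x else 0
  have hA : ∀ b μ, (∑ p : Fin d, ∑ s : Fin e, α p s μ * A' b p s) =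
      ∑ x : Fin n, ∑ y : Fin m,
        if (φ x).2 = (φ i).2 ∧ (ψ y).2 = b then α (φ x).1 (ψ y).1 μ * A x y else 0 := by
    intro b μ
    simp only [A', Finset.mul_sum]
    rw [← Finset.sum_product']
    rw [Finset.sum_comm]
    refine Finset.sum_congr rfl fun x _ => ?_
    rw [Finset.sum_comm]
    refine Finset.sum_congr rfl fun y _ => ?_
    rw [Finset.sum_eq_single ((φ x).1, (ψ y).1)]
    · simp [Prod.ext_iff]
    · rintro ⟨p, s⟩ _ hne
      rw [if_neg, mul_zero]
      rintro ⟨h1, h2⟩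
      exact hne (by rw [h1, h2])
    · simp
  have hB : ∀ b μ, (∑ p : Fin d, ∑ s : Fin e, β p s μ * B' b s p) =
      ∑ x : Fin n, ∑ y : Fin m,
        if (φ x).2 = (φ j).2 ∧ (ψ y).2 = b then β (φ x).1 (ψ y).1 μ * B y x else 0 := by
    intro b μ
    simp only [B', Finset.mul_sum]
    rw [← Finset.sum_product']
    rw [Finset.sum_comm]
    refine Finset.sum_congr rfl fun x _ => ?_
    rw [Finset.sum_comm]
    refine Finset.sum_congr rfl fun y _ => ?_
    rw [Finset.sum_eq_single ((φ x).1, (ψ y).1)]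
    · simp [Prod.ext_iff]
    · rintro ⟨p, s⟩ _ hne
      rw [if_neg, mul_zero]
      rintro ⟨h1, h2⟩
      exact hne (by rw [h1, h2])
    · simp
  have hA1 : ∀ b s, A' b (φ i).1 s = ∑ y : Fin m, if ψ y = (s, b) then A i y else 0 := by
    intro b s
    simp only [A']
    rw [Finset.sum_eq_single i]
    · simp
    · intro x _ hx
      refine Finset.sum_eq_zero fun y _ => if_neg fun h => hx (φ.injective ?_)
      rw [h.1]
    · simp
  have hB1 : ∀ b s, B' b s (φ j).1 = ∑ y : Fin m, if ψ y = (s, b) then B y j else 0 := by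
    intro b s
    simp only [B']
    rw [Finset.sum_eq_single j]
    · simp
    · intro x _ hx
      refine Finset.sum_eq_zero fun y _ => if_neg fun h => hx (φ.injective ?_)
      rw [h.1]
    · simp
  have hAB : (A * B) i j = ∑ b : Fin c, (A' b * B' b) (φ i).1 (φ j).1 := by
    simp only [Matrix.mul_apply, hA1, hB1]
    rw [Finset.sum_comm, ← Finset.sum_product']
    have : ∀ z : Fin e × Fin c, (∑ y : Fin m, if ψ y = (z.1, z.2) then A i y else 0) *
        (∑ y : Fin m, if ψ y = (z.1, z.2) then B y j else 0) =
        ∑ y : Fin m, if ψ y = z then A i y * B y j else 0 := by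
      intro z
      rw [Finset.sum_mul]
      refine Finset.sum_congr rfl fun y _ => ?_
      split_ifs with hy
      · rw [Finset.sum_eq_single y]
        · rw [if_pos hy]
        · intro y' _ hy'
          exact if_neg fun h => hy' (ψ.injective (h.trans hy.symm))
        · simp
      · rw [zero_mul]
    simp only [this]
    rw [Finset.sum_comm]
    simp
  rw [hAB]
  simp only [h, hA, hB]
  rw [Finset.sum_comm]
  refine Finset.sum_congr rfl fun μ _ => ?_
  rw [Finset.mul_sum]
  simp only [mul_assoc]

/-- Distributed block matrix multiplication: the linear combinations of blocks are formed at the nodes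
`pos`, the products of the combinations at the nodes `wk`, and the entries of the result at the nodes
`opos`. -/
theorem solvableMM_of_assignment {n m k d e t r c q D a₁ a₂ a₃ : ℕ} {F : Type u} [Field F]
    (enc : F → Fin q → CliqueMessage n) (henc : Function.Injective enc)
    (halg : HasAlgebraicAlgorithm F d e t)
    (φ : Fin n ↪ Fin d × Fin r) (ψ : Fin m ↪ Fin e × Fin c)
    (pos : Fin k × Fin r × Fin c → Fin n) (wk : Fin k × Fin t → Fin n)
    (opos : Fin k × Fin r × Fin r → Fin n)
    (hpos : ∀ v, (Finset.univ.filter fun x => pos x = v).card ≤ a₁)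
    (hwk : ∀ v, (Finset.univ.filter fun x => wk x = v).card ≤ a₂)
    (hopos : ∀ v, (Finset.univ.filter fun x => opos x = v).card ≤ a₃)
    (h₁ : k * (m * 2) ≤ D * n) (h₂ : a₁ * (d * (e * 2)) ≤ D * n)
    (h₃ : a₁ * (t * 2) ≤ D * n) (h₄ : a₂ * (r * (c * 2)) ≤ D * n)
    (h₅ : a₂ * (r * r) ≤ D * n) (h₆ : a₃ * t ≤ D * n)
    (h₇ : a₃ * (d * (d * 2)) ≤ D * n) (h₈ : k * (n * 2) ≤ D * n) :
    SolvableMM n m k F (16 * D * q) := by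
  classical
  obtain ⟨α, β, lam, halg⟩ := halg
  let Inp := (Fin k → Fin m → F) × (Fin k → Fin m → F)
  -- Packets of the four routings: input entries, entries of the combined blocks, entries of the
  -- block products, output entries. In `E₁` and `E₂` the Boolean tells `A` (`true`) from `B`, with
  -- `B` indexed by its column first; in `E₄` it tells the row owner (`true`) from the column owner.
  -- The hypotheses `h₁` to `h₈` are the send and receive loads of these routings, in order.
  let E₁ := Fin k × Fin n × Fin m × Bool
  let E₂ := Fin k × Fin t × Fin r × Fin c × Bool
  let E₃ := Fin k × Fin t × Fin r × Fin r
  let E₄ := Fin k × Fin n × Fin n × Bool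
  have r₁ : CliqueComputes (4 * D * q) (fun (x : Fin n → E₁ → F) l e =>
      if pos (e.1, (φ e.2.1).2, (ψ e.2.2.1).2) = l then x e.2.1 e else 0) := by
    refine CliqueComputes.route enc henc (fun e : E₁ => e.2.1) _ (fun v => ?_) (fun v => ?_)
    · refine (card_fiber_comp_le (fun e : E₁ => e.2.1) id (fun e => (e.1, e.2.2.1, e.2.2.2))
        (fun _ => rfl) ?_ card_fiber_id_le v).trans (by simpa using h₁)
      rintro ⟨s, i, j, b⟩ ⟨s', i', j', b'⟩ h
      simp only [E₁, Prod.mk.injEq] at h ⊢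
      tauto
    · refine (card_fiber_comp_le (fun e : E₁ => (e.1, (φ e.2.1).2, (ψ e.2.2.1).2)) pos
        (fun e => ((φ e.2.1).1, (ψ e.2.2.1).1, e.2.2.2))
        (fun _ => rfl) ?_ hpos v).trans (by simpa using h₂)
      rintro ⟨s, i, j, b⟩ ⟨s', i', j', b'⟩ h
      simp only [E₁, Prod.mk.injEq] at h ⊢
      refine ⟨h.1.1, φ.injective (Prod.ext h.2.1 h.1.2.1), ψ.injective (Prod.ext h.2.2.1 h.1.2.2),
        h.2.2.2⟩
  have r₂ : CliqueComputes (4 * D * q) (fun (x : Fin n → E₂ → F) l e =>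
      if wk (e.1, e.2.1) = l then x (pos (e.1, e.2.2.1, e.2.2.2.1)) e else 0) := by
    refine CliqueComputes.route enc henc (fun e : E₂ => pos (e.1, e.2.2.1, e.2.2.2.1)) _
      (fun v => ?_) (fun v => ?_)
    · refine (card_fiber_comp_le (fun e : E₂ => (e.1, e.2.2.1, e.2.2.2.1)) pos
        (fun e => (e.2.1, e.2.2.2.2)) (fun _ => rfl) ?_ hpos v).trans (by simpa using h₃)
      rintro ⟨s, i, j, b, z⟩ ⟨s', i', j', b', z'⟩ h
      simp only [E₂, Prod.mk.injEq] at h ⊢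
      tauto
    · refine (card_fiber_comp_le (fun e : E₂ => (e.1, e.2.1)) wk
        (fun e => (e.2.2.1, e.2.2.2.1, e.2.2.2.2)) (fun _ => rfl) ?_ hwk v).trans (by simpa using h₄)
      rintro ⟨s, i, j, b, z⟩ ⟨s', i', j', b', z'⟩ h
      simp only [E₂, Prod.mk.injEq] at h ⊢
      tauto
  have r₃ : CliqueComputes (4 * D * q) (fun (x : Fin n → E₃ → F) l e =>
      if opos (e.1, e.2.2.1, e.2.2.2) = l then x (wk (e.1, e.2.1)) e else 0) := by
    refine CliqueComputes.route enc henc (fun e : E₃ => wk (e.1, e.2.1)) _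
      (fun v => ?_) (fun v => ?_)
    · refine (card_fiber_comp_le (fun e : E₃ => (e.1, e.2.1)) wk
        (fun e => (e.2.2.1, e.2.2.2)) (fun _ => rfl) ?_ hwk v).trans (by simpa using h₅)
      rintro ⟨s, i, j, b⟩ ⟨s', i', j', b'⟩ h
      simp only [E₃, Prod.mk.injEq] at h ⊢
      tauto
    · refine (card_fiber_comp_le (fun e : E₃ => (e.1, e.2.2.1, e.2.2.2)) opos
        (fun e => e.2.1) (fun _ => rfl) ?_ hopos v).trans (by simpa using h₆)
      rintro ⟨s, i, j, b⟩ ⟨s', i', j', b'⟩ h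
      simp only [E₃, Prod.mk.injEq] at h ⊢
      tauto
  have r₄ : CliqueComputes (4 * D * q) (fun (x : Fin n → E₄ → F) l e =>
      if (if e.2.2.2 then e.2.1 else e.2.2.1) = l then
        x (opos (e.1, (φ e.2.1).2, (φ e.2.2.1).2)) e else 0) := by
    refine CliqueComputes.route enc henc (fun e : E₄ => opos (e.1, (φ e.2.1).2, (φ e.2.2.1).2)) _
      (fun v => ?_) (fun v => ?_)
    · refine (card_fiber_comp_le (fun e : E₄ => (e.1, (φ e.2.1).2, (φ e.2.2.1).2)) opos
        (fun e => ((φ e.2.1).1, (φ e.2.2.1).1, e.2.2.2))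
        (fun _ => rfl) ?_ hopos v).trans (by simpa using h₇)
      rintro ⟨s, i, j, b⟩ ⟨s', i', j', b'⟩ h
      simp only [E₄, Prod.mk.injEq] at h ⊢
      refine ⟨h.1.1, φ.injective (Prod.ext h.2.1 h.1.2.1), φ.injective (Prod.ext h.2.2.1 h.1.2.2),
        h.2.2.2⟩
    · refine (card_fiber_comp_le (fun e : E₄ => if e.2.2.2 then e.2.1 else e.2.2.1) id
        (fun e => (e.1, if e.2.2.2 then e.2.2.1 else e.2.1, e.2.2.2))
        (fun _ => rfl) ?_ card_fiber_id_le v).trans (by simpa using h₈)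
      rintro ⟨s, i, j, b⟩ ⟨s', i', j', b'⟩ h
      simp only [E₄, Prod.mk.injEq] at h ⊢
      obtain ⟨h1, h2, h3, rfl⟩ := h
      cases b <;> simp at h1 h3 <;> tauto
  have l₀ := CliqueComputes.local (n := n) (fun _ (z : Inp) (e : E₁) =>
    if e.2.2.2 then z.1 e.1 e.2.2.1 else z.2 e.1 e.2.2.1)
  have l₁ := CliqueComputes.local (n := n) (fun _ (y : E₁ → F) (e : E₂) =>
    ∑ i : Fin n, ∑ j : Fin m, if (φ i).2 = e.2.2.1 ∧ (ψ j).2 = e.2.2.2.1 then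
      (if e.2.2.2.2 then α else β) (φ i).1 (ψ j).1 e.2.1 * y (e.1, i, j, e.2.2.2.2) else 0)
  have l₂ := CliqueComputes.local (n := n) (fun _ (y : E₂ → F) (e : E₃) =>
    ∑ b : Fin c, y (e.1, e.2.1, e.2.2.1, b, true) * y (e.1, e.2.1, e.2.2.2, b, false))
  have l₃ := CliqueComputes.local (n := n) (fun _ (y : E₃ → F) (e : E₄) =>
    ∑ μ : Fin t, lam (φ e.2.1).1 (φ e.2.2.1).1 μ * y (e.1, μ, (φ e.2.1).2, (φ e.2.2.1).2))
  have l₄ := CliqueComputes.local (n := n) (fun v (y : E₄ → F) =>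
    ((fun s j => y (s, v, j, true), fun s i => y (s, i, v, false)) :
      (Fin k → Fin n → F) × (Fin k → Fin n → F)))
  have hall := l₄.comp (r₄.comp (l₃.comp (r₃.comp (l₂.comp (r₂.comp (l₁.comp (r₁.comp l₀)))))))
  have hT : 0 + 4 * D * q + 0 + 4 * D * q + 0 + 4 * D * q + 0 + 4 * D * q + 0 = 16 * D * q := by ring
  rw [hT] at hall
  obtain ⟨P, hP⟩ := hall
  refine ⟨P, fun A B l => ?_⟩
  rw [hP]
  have hsum : ∀ (s : Fin k) (i j : Fin n), (A s * B s) i j = _ := fun s i j =>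
    mul_apply_of_block_algorithm halg φ ψ (A s) (B s) i j
  refine Prod.ext ?_ ?_
  · funext s j
    dsimp only
    rw [hsum, if_pos (by simp)]
    refine Finset.sum_congr rfl fun μ _ => ?_
    simp only [if_true, Bool.false_eq_true, if_false]
    congr 1
    refine Finset.sum_congr rfl fun b _ => ?_
    congr 1
    · refine Finset.sum_congr rfl fun x _ => Finset.sum_congr rfl fun y _ => ?_
      by_cases h : (φ x).2 = (φ l).2 ∧ (ψ y).2 = b
      · rw [if_pos h, if_pos h, if_pos (by rw [h.1, h.2])]
      · rw [if_neg h, if_neg h]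
    · refine Finset.sum_congr rfl fun x _ => Finset.sum_congr rfl fun y _ => ?_
      by_cases h : (φ x).2 = (φ j).2 ∧ (ψ y).2 = b
      · rw [if_pos h, if_pos h, if_pos (by rw [h.1, h.2])]
      · rw [if_neg h, if_neg h]
  · funext s j
    dsimp only
    rw [hsum, if_pos (by simp)]
    refine Finset.sum_congr rfl fun μ _ => ?_
    simp only [if_true, Bool.false_eq_true, if_false]
    congr 1
    refine Finset.sum_congr rfl fun b _ => ?_
    congr 1
    · refine Finset.sum_congr rfl fun x _ => Finset.sum_congr rfl fun y _ => ?_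
      by_cases h : (φ x).2 = (φ j).2 ∧ (ψ y).2 = b
      · rw [if_pos h, if_pos h, if_pos (by rw [h.1, h.2])]
      · rw [if_neg h, if_neg h]
    · refine Finset.sum_congr rfl fun x _ => Finset.sum_congr rfl fun y _ => ?_
      by_cases h : (φ x).2 = (φ l).2 ∧ (ψ y).2 = b
      · rw [if_pos h, if_pos h, if_pos (by rw [h.1, h.2])]
      · rw [if_neg h, if_neg h]

theorem exists_balanced_assignment (P : Type*) [Fintype P] {n : ℕ} (hn : 0 < n) :
    ∃ f : P → Fin n, ∀ v, (Finset.univ.filter fun x => f x = v).card ≤ Fintype.card P / n + 1 := by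
  classical
  have hcard : Fintype.card P ≤ Fintype.card (Fin n × Fin (Fintype.card P / n + 1)) := by
    simpa using (Nat.lt_mul_div_succ (Fintype.card P) hn).le
  obtain ⟨g⟩ := Function.Embedding.nonempty_of_card_le hcard
  refine ⟨fun x => (g x).1, fun v => ?_⟩
  have := card_fiber_comp_le (f := fun x => (g x).1) (fun x => (g x).1) id (fun x => (g x).2)
    (fun _ => rfl) (fun x y h => g.injective (by simpa [Prod.ext_iff] using h)) card_fiber_id_le v
  simpa using this

theorem exists_embedding_blocks {n d : ℕ} (hd : 0 < d) (hdn : d ≤ n) :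
    ∃ r : ℕ, Nonempty (Fin n ↪ Fin d × Fin r) ∧ (r : ℝ) ≤ 2 * (n / d) := by
  have hd' : (0 : ℝ) < d := by exact_mod_cast hd
  refine ⟨⌈(n : ℝ) / d⌉₊, Function.Embedding.nonempty_of_card_le ?_, ?_⟩
  · have h := Nat.le_ceil ((n : ℝ) / d)
    rw [div_le_iff₀ hd'] at h
    rw [Fintype.card_prod, Fintype.card_fin, Fintype.card_fin, Fintype.card_fin, mul_comm]
    exact_mod_cast h
  · have h1 : (1 : ℝ) ≤ n / d := by
      rw [le_div_iff₀ hd', one_mul]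
      exact_mod_cast hdn
    have h2 := (Nat.ceil_lt_add_one (a := (n : ℝ) / d) (by positivity)).le
    linarith

theorem RoundsMMLe.mono {n m k : ℕ} {F : Type u} [Field F] {R R' : ℝ}
    (h : RoundsMMLe n m k F R) (hR : R ≤ R') : RoundsMMLe n m k F R' := by
  obtain ⟨T, hT, hTR⟩ := h
  exact ⟨T, hT, hTR.trans hR⟩

-- With balanced assignments, a node handles at most `4kX + 1` positions in the factors, `ρ` block
-- products and `4kY + 1` positions in the results, where `X = m/(de)`, `Y = n/d²`, `ρ = kt/n + 1`.
-- The bounds `d * d ≤ t` and `d * e ≤ t` absorb the loads caused by the rounding terms `+ 1`.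
set_option maxHeartbeats 1000000 in
theorem roundsMMLe_of_algorithm {n m k d e t q : ℕ} {F : Type u} [Field F]
    (enc : F → Fin q → CliqueMessage n) (henc : Function.Injective enc)
    (halg : HasAlgebraicAlgorithm F d e t) (hk : 1 ≤ k) (hd : 0 < d) (he : 0 < e) (hdn : d ≤ n)
    (hem : e ≤ m) (hdt : d * d ≤ t) (hdet : d * e ≤ t) :
    RoundsMMLe n m k F (144 * q * (((k : ℝ) * t / n + 1) * (m / (d * e) + n / (d * d) + 1) + k +
      k * m / n)) := by
  have hn : 0 < n := hd.trans_le hdn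
  obtain ⟨r, ⟨φ⟩, hr⟩ := exists_embedding_blocks hd hdn
  obtain ⟨c, ⟨ψ⟩, hc⟩ := exists_embedding_blocks he hem
  obtain ⟨pos, hpos⟩ := exists_balanced_assignment (Fin k × Fin r × Fin c) hn
  obtain ⟨wk, hwk⟩ := exists_balanced_assignment (Fin k × Fin t) hn
  obtain ⟨opos, hopos⟩ := exists_balanced_assignment (Fin k × Fin r × Fin r) hn
  have hn' : (0 : ℝ) < n := by exact_mod_cast hn
  have hd' : (0 : ℝ) < d := by exact_mod_cast hd
  have he' : (0 : ℝ) < e := by exact_mod_cast he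
  have hk' : (1 : ℝ) ≤ k := by exact_mod_cast hk
  have hdt' : (d : ℝ) * d ≤ t := by exact_mod_cast hdt
  have hdet' : (d : ℝ) * e ≤ t := by exact_mod_cast hdet
  have ht0 : (0 : ℝ) ≤ t := Nat.cast_nonneg _
  obtain ⟨X, hX⟩ : ∃ X : ℝ, X = m / (d * e) := ⟨_, rfl⟩
  obtain ⟨Y, hY⟩ : ∃ Y : ℝ, Y = n / (d * d) := ⟨_, rfl⟩
  obtain ⟨ρ, hρ⟩ : ∃ ρ : ℝ, ρ = (k : ℝ) * t / n + 1 := ⟨_, rfl⟩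
  obtain ⟨Z, hZ⟩ : ∃ Z : ℝ, Z = (k : ℝ) * m / n := ⟨_, rfl⟩
  rw [← hX, ← hY, ← hρ, ← hZ]
  have hX0 : 0 ≤ X := by rw [hX]; positivity
  have hY0 : 0 ≤ Y := by rw [hY]; positivity
  have hZ0 : 0 ≤ Z := by rw [hZ]; positivity
  have hρ1 : 1 ≤ ρ := by
    have : 0 ≤ (k : ℝ) * t / n := by positivity
    linarith
  have hρ0 : 0 < ρ := by linarith
  have hXm : X * (d * e) = m := by rw [hX]; field_simp
  have hYn : Y * (d * d) = n := by rw [hY]; field_simp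
  have hZn : Z * n = k * m := by rw [hZ]; field_simp
  have hkt : (k : ℝ) * t ≤ ρ * n := by
    rw [hρ, add_mul, div_mul_cancel₀ _ hn'.ne']
    linarith
  have htρ : (t : ℝ) ≤ ρ * n := le_trans (by nlinarith) hkt
  have hrc : (r : ℝ) * c ≤ 4 * n * X := by
    calc (r : ℝ) * c ≤ (2 * (n / d)) * (2 * (m / e)) := by gcongr
      _ = 4 * n * X := by rw [hX]; field_simp; ring
  have hrr : (r : ℝ) * r ≤ 4 * n * Y := by
    calc (r : ℝ) * r ≤ (2 * (n / d)) * (2 * (n / d)) := by gcongr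
      _ = 4 * n * Y := by rw [hY]; field_simp; ring
  have ha₁ : ((Fintype.card (Fin k × Fin r × Fin c) / n + 1 : ℕ) : ℝ) ≤ 4 * k * X + 1 := by
    push_cast
    gcongr
    refine Nat.cast_div_le.trans ?_
    rw [div_le_iff₀ hn']
    simp only [Fintype.card_prod, Fintype.card_fin]
    push_cast
    nlinarith
  have ha₂ : ((Fintype.card (Fin k × Fin t) / n + 1 : ℕ) : ℝ) ≤ ρ := by
    push_cast
    rw [hρ]
    gcongr
    refine Nat.cast_div_le.trans ?_
    simp
  have ha₃ : ((Fintype.card (Fin k × Fin r × Fin r) / n + 1 : ℕ) : ℝ) ≤ 4 * k * Y + 1 := by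
    push_cast
    gcongr
    refine Nat.cast_div_le.trans ?_
    rw [div_le_iff₀ hn']
    simp only [Fintype.card_prod, Fintype.card_fin]
    push_cast
    nlinarith
  generalize Fintype.card (Fin k × Fin r × Fin c) / n + 1 = a₁ at *
  generalize Fintype.card (Fin k × Fin t) / n + 1 = a₂ at *
  generalize Fintype.card (Fin k × Fin r × Fin r) / n + 1 = a₃ at *
  obtain ⟨W, hW⟩ : ∃ W : ℝ, W = ρ * (X + Y + 1) + k + Z := ⟨_, rfl⟩
  have hρX : 0 ≤ ρ * X := by positivity
  have hρY : 0 ≤ ρ * Y := by positivity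
  have hWe : W = ρ * X + ρ * Y + ρ + k + Z := by rw [hW]; ring
  -- Every load will be at most `w * n` with `w ≤ 8 * W`. The final constant is `144 = 16 * 9`: four
  -- routings of cost `4 * D * q`, and `D = ⌈8 * W⌉₊ ≤ 9 * W` because `W ≥ 1`.
  have hD : ∀ N : ℕ, ∀ w : ℝ, (N : ℝ) ≤ w * n → w ≤ 8 * W → N ≤ ⌈8 * W⌉₊ * n := by
    intro N w h1 h2
    have h3 : (N : ℝ) ≤ (⌈8 * W⌉₊ : ℝ) * n :=
      h1.trans (mul_le_mul_of_nonneg_right (h2.trans (Nat.le_ceil _)) hn'.le)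
    exact_mod_cast h3
  have hsolv := solvableMM_of_assignment (D := ⌈8 * W⌉₊) enc henc halg φ ψ pos wk opos hpos hwk hopos
    (hD _ (2 * Z) (by push_cast; nlinarith) (by rw [hWe]; linarith))
    (hD _ (8 * Z + 2 * ρ) (by
      push_cast
      calc (a₁ : ℝ) * (d * (e * 2)) ≤ (4 * k * X + 1) * (d * (e * 2)) := by gcongr
        _ = 8 * (k * (X * (d * e))) + 2 * (d * e) := by ring
        _ ≤ (8 * Z + 2 * ρ) * n := by rw [hXm, ← hZn]; linarith) (by rw [hWe]; linarith))
    (hD _ (8 * (ρ * X) + 2 * ρ) (by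
      push_cast
      calc (a₁ : ℝ) * (t * 2) ≤ (4 * k * X + 1) * (t * 2) := by gcongr
        _ = 8 * ((k * t) * X) + 2 * t := by ring
        _ ≤ 8 * ((ρ * n) * X) + 2 * (ρ * n) := by gcongr
        _ = (8 * (ρ * X) + 2 * ρ) * n := by ring) (by rw [hWe]; linarith))
    (hD _ (8 * (ρ * X)) (by
      push_cast
      calc (a₂ : ℝ) * (r * (c * 2)) = 2 * a₂ * (r * c) := by ring
        _ ≤ 2 * ρ * (4 * n * X) := by gcongr
        _ = (8 * (ρ * X)) * n := by ring) (by rw [hWe]; linarith))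
    (hD _ (4 * (ρ * Y)) (by
      push_cast
      calc (a₂ : ℝ) * (r * r) ≤ ρ * (4 * n * Y) := by gcongr
        _ = (4 * (ρ * Y)) * n := by ring) (by rw [hWe]; linarith))
    (hD _ (4 * (ρ * Y) + ρ) (by
      push_cast
      calc (a₃ : ℝ) * t ≤ (4 * k * Y + 1) * t := by gcongr
        _ = 4 * ((k * t) * Y) + t := by ring
        _ ≤ 4 * ((ρ * n) * Y) + ρ * n := by gcongr
        _ = (4 * (ρ * Y) + ρ) * n := by ring) (by rw [hWe]; linarith))
    (hD _ (8 * k + 2 * ρ) (by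
      push_cast
      calc (a₃ : ℝ) * (d * (d * 2)) ≤ (4 * k * Y + 1) * (d * (d * 2)) := by gcongr
        _ = 8 * (k * (Y * (d * d))) + 2 * (d * d) := by ring
        _ ≤ (8 * k + 2 * ρ) * n := by rw [hYn]; linarith) (by rw [hWe]; linarith))
    (hD _ (2 * k) (by push_cast; linarith) (by rw [hWe]; linarith))
  rw [← hW]
  refine ⟨_, hsolv, ?_⟩
  push_cast
  have hW1 : 1 ≤ W := by rw [hWe]; linarith
  have hceil : (⌈8 * W⌉₊ : ℝ) ≤ 9 * W := by
    have := (Nat.ceil_lt_add_one (a := 8 * W) (by linarith)).le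
    linarith
  calc 16 * (⌈8 * W⌉₊ : ℝ) * q ≤ 16 * (9 * W) * q := by gcongr
    _ = 144 * q * W := by ring

/-! ### Encoding of field elements and degenerate sizes -/

/-- Elements of a field of polynomially bounded size are encoded by boundedly many messages. -/
theorem exists_encoding (p : Polynomial ℕ) : ∃ q : ℕ, ∀ (n : ℕ) (F : Type u) [Finite F], 2 ≤ n →
    Nat.card F ≤ p.eval n → ∃ enc : F → Fin q → CliqueMessage n, Function.Injective enc := by
  refine ⟨p.eval 1 + p.natDegree, fun n F _ hn hF => ?_⟩
  have := Fintype.ofFinite F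
  have h1 : p.eval n ≤ p.eval 1 * n ^ p.natDegree := by
    rw [Polynomial.eval_eq_sum_range, Polynomial.eval_eq_sum_range, Finset.sum_mul]
    refine Finset.sum_le_sum fun i hi => ?_
    rw [one_pow, mul_one]
    exact Nat.mul_le_mul_left _ (Nat.pow_le_pow_right (by omega)
      (by have := Finset.mem_range.1 hi; omega))
  have h2 : p.eval 1 ≤ n ^ p.eval 1 := (Nat.lt_pow_self (by omega)).le
  have h3 : n ≤ 2 ^ Nat.clog 2 n := Nat.le_pow_clog (by omega) n
  have hcard : Fintype.card F ≤ Fintype.card (Fin (p.eval 1 + p.natDegree) → CliqueMessage n) := by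
    rw [← Nat.card_eq_fintype_card]
    simp only [CliqueMessage, Fintype.card_fun, Fintype.card_bool, Fintype.card_fin]
    calc Nat.card F ≤ p.eval 1 * n ^ p.natDegree := hF.trans h1
      _ ≤ n ^ p.eval 1 * n ^ p.natDegree := Nat.mul_le_mul_right _ h2
      _ = n ^ (p.eval 1 + p.natDegree) := (pow_add _ _ _).symm
      _ ≤ (2 ^ Nat.clog 2 n) ^ (p.eval 1 + p.natDegree) := Nat.pow_le_pow_left h3 _
  obtain ⟨g⟩ := Function.Embedding.nonempty_of_card_le hcard
  exact ⟨g, g.injective⟩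

/-- For `n = 1` messages are empty, but the only node already holds the whole input. -/
theorem solvableMM_zero_of_subsingleton {n m k : ℕ} [Subsingleton (Fin n)] (F : Type u) [Field F] :
    SolvableMM n m k F 0 := by
  obtain ⟨P, hP⟩ := CliqueComputes.local (n := n)
    (fun _ (z : (Fin k → Fin m → F) × (Fin k → Fin m → F)) =>
      ((fun s _ => ∑ y, z.1 s y * z.2 s y, fun s _ => ∑ y, z.1 s y * z.2 s y) :
        (Fin k → Fin n → F) × (Fin k → Fin n → F)))
  refine ⟨P, fun A B l => ?_⟩
  rw [hP]
  refine Prod.ext ?_ ?_ <;>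
  · funext s j
    simp [Subsingleton.elim j l, Matrix.mul_apply]

theorem solvableMM_zero_of_inner_zero {n k : ℕ} (F : Type u) [Field F] :
    SolvableMM n 0 k F 0 := by
  obtain ⟨P, hP⟩ := CliqueComputes.local (n := n)
    (fun _ (_ : (Fin k → Fin 0 → F) × (Fin k → Fin 0 → F)) =>
      ((fun _ _ => 0, fun _ _ => 0) : (Fin k → Fin n → F) × (Fin k → Fin n → F)))
  refine ⟨P, fun A B l => ?_⟩
  rw [hP]
  refine Prod.ext ?_ ?_ <;>
  · funext s j
    simp [Matrix.mul_apply]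

/-- Block matrix multiplication over fields of polynomially bounded size. -/
theorem exists_rounds_le_of_algorithm (p : Polynomial ℕ) : ∃ K : ℝ, 0 < K ∧
    ∀ (F : Type u) [Field F] [Finite F] (n m k d e t : ℕ), Nat.card F ≤ p.eval n → 1 ≤ k → 0 < d →
      d ≤ n → HasAlgebraicAlgorithm F d e t → (1 ≤ m → 0 < e) → e ≤ m ⊔ 1 → d * d ≤ t → d * e ≤ t →
      RoundsMMLe n m k F (K * (((k : ℝ) * t / n + 1) * (m / (d * e) + n / (d * d) + 1) + k +
        k * m / n)) := by
  obtain ⟨q, hq⟩ := exists_encoding.{u} p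
  refine ⟨144 * q + 1, by positivity, fun F _ _ n m k d e t hF hk hd hdn halg he hem hdt hdet => ?_⟩
  have hpos : (0 : ℝ) ≤ ((k : ℝ) * t / n + 1) * (m / (d * e) + n / (d * d) + 1) + k + k * m / n := by
    positivity
  rcases Nat.eq_zero_or_pos m with rfl | hm
  · exact ⟨0, solvableMM_zero_of_inner_zero F, by rw [Nat.cast_zero]; positivity⟩
  · by_cases hn : n ≤ 1
    · have : Subsingleton (Fin n) := Fin.subsingleton_iff_le_one.2 hn
      exact ⟨0, solvableMM_zero_of_subsingleton F, by rw [Nat.cast_zero]; positivity⟩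
    · obtain ⟨enc, henc⟩ := hq n F (by omega) hF
      refine (roundsMMLe_of_algorithm enc henc halg hk hd (he hm) hdn
        (by rwa [max_eq_left hm] at hem) hdt hdet).mono ?_
      exact mul_le_mul_of_nonneg_right (by linarith) hpos

/-! ### Bilinear rank: constructions and lower bounds -/

namespace HasAlgebraicAlgorithm

variable {F : Type*} [Field F]

/-- Pad the inner dimension with zeros. -/
theorem of_le {n m m' t : ℕ} (h : HasAlgebraicAlgorithm F n m t) (hm : m' ≤ m) :
    HasAlgebraicAlgorithm F n m' t := by
  classical
  obtain ⟨α, β, lam, h⟩ := h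
  let f : Fin m' ↪ Fin m := Fin.castLEEmb hm
  refine ⟨fun i j μ => α i (f j) μ, fun i j μ => β i (f j) μ, lam, fun A B i j => ?_⟩
  have key := h (Matrix.of fun i y => ∑ z, if f z = y then A i z else 0)
    (Matrix.of fun y i => ∑ z, if f z = y then B z i else 0) i j
  have hswap : ∀ (w : Fin m → F) (v : Fin m' → F),
      ∑ y, w y * (∑ z, if f z = y then v z else 0) = ∑ z, w (f z) * v z := by
    intro w v
    simp only [Finset.mul_sum]
    rw [Finset.sum_comm]
    simp
  have hmul : (A * B) i j = ∑ y, (∑ z, if f z = y then A i z else 0) *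
      (∑ z, if f z = y then B z j else 0) := by
    rw [hswap, Matrix.mul_apply]
    refine Finset.sum_congr rfl fun z _ => ?_
    congr 1
    rw [Finset.sum_eq_single z]
    · simp
    · intro z' _ hz'
      exact if_neg fun h => hz' (f.injective h)
    · simp
  simp only [Matrix.mul_apply, Matrix.of_apply] at key
  rw [hmul, key]
  simp only [hswap]

/-- Cut the inner dimension into `s` slices, run the algorithm on each and add the results. -/
theorem mul_inner {n m t : ℕ} (h : HasAlgebraicAlgorithm F n m t) (s : ℕ) :
    HasAlgebraicAlgorithm F n (m * s) (t * s) := by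
  classical
  obtain ⟨α, β, lam, h⟩ := h
  let f : Fin m × Fin s ≃ Fin (m * s) := finProdFinEquiv
  let g : Fin t × Fin s ≃ Fin (t * s) := finProdFinEquiv
  refine ⟨fun i j μ => if (f.symm j).2 = (g.symm μ).2 then α i (f.symm j).1 (g.symm μ).1 else 0,
    fun i j μ => if (f.symm j).2 = (g.symm μ).2 then β i (f.symm j).1 (g.symm μ).1 else 0,
    fun i j μ => lam i j (g.symm μ).1, fun A B i j => ?_⟩
  rw [Matrix.mul_apply, ← f.sum_comp, ← g.sum_comp, Fintype.sum_prod_type_right,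
    Fintype.sum_prod_type_right]
  refine Finset.sum_congr rfl fun b _ => ?_
  have key := h (Matrix.of fun i y => A i (f (y, b)))
    (Matrix.of fun y i => B (f (y, b)) i) i j
  simp only [Matrix.mul_apply, Matrix.of_apply] at key
  rw [key]
  refine Finset.sum_congr rfl fun μ _ => ?_
  have hs : ∀ (w : Fin m → F) (v : Fin (m * s) → F),
      ∑ y, (if (f.symm y).2 = b then w (f.symm y).1 else 0) * v y = ∑ z, w z * v (f (z, b)) := by
    intro w v
    rw [← f.sum_comp, Fintype.sum_prod_type_right]
    simp only [Equiv.symm_apply_apply, ite_mul, zero_mul]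
    rw [Finset.sum_eq_single b]
    · simp
    · intro b' _ hb'
      simp [hb']
    · simp
  simp only [Equiv.symm_apply_apply]
  congr 1
  · congr 1
    refine Finset.sum_congr rfl fun x _ => ?_
    exact (hs (fun z => α x z μ) (fun y => A x y)).symm
  · refine Finset.sum_congr rfl fun x _ => ?_
    exact (hs (fun z => β x z μ) (fun y => B y x)).symm

theorem outer (F : Type*) [Field F] (n : ℕ) : HasAlgebraicAlgorithm F n 1 (n * n) := by
  classical
  let g : Fin n × Fin n ≃ Fin (n * n) := finProdFinEquiv
  refine ⟨fun i _ μ => if (g.symm μ).1 = i then 1 else 0,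
    fun i _ μ => if (g.symm μ).2 = i then 1 else 0,
    fun i j μ => if g.symm μ = (i, j) then 1 else 0, fun A B i j => ?_⟩
  rw [Matrix.mul_apply, ← g.sum_comp, Finset.sum_eq_single (i, j)]
  · simp
  · intro x _ hx
    simp [hx]
  · simp

theorem trivial (F : Type*) [Field F] (n m : ℕ) : HasAlgebraicAlgorithm F n m (n * n * m) := by
  simpa using (outer F n).mul_inner m

/-- The `t` linear forms in `A` determine `A`: if all vanish then `A * B = 0` for every `B`, so `A =
0`. This gives an injection from a space of dimension `n * m` into `F^t`. -/
theorem mul_le_rank {n m t : ℕ} (h : HasAlgebraicAlgorithm F n m t) : n * m ≤ t := by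
  classical
  obtain ⟨α, β, lam, h⟩ := h
  let Φ : Matrix (Fin n) (Fin m) F →ₗ[F] (Fin t → F) :=
    { toFun := fun A μ => ∑ i', ∑ j', α i' j' μ * A i' j'
      map_add' := fun A B => by
        funext μ
        simp [mul_add, Finset.sum_add_distrib]
      map_smul' := fun c A => by
        funext μ
        simp only [Matrix.smul_apply, smul_eq_mul, RingHom.id_apply, Pi.smul_apply, Finset.mul_sum]
        exact Finset.sum_congr rfl fun _ _ => Finset.sum_congr rfl fun _ _ => by ring }
  have hΦ : Function.Injective Φ := by
    rw [injective_iff_map_eq_zero]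
    intro A hA
    ext i j
    have h1 := h A (Matrix.single j i 1) i i
    have h2 : ∀ μ, (∑ i', ∑ j', α i' j' μ * A i' j') = 0 := fun μ => congrFun hA μ
    simpa [h2] using h1
  simpa [Module.finrank_matrix] using LinearMap.finrank_le_finrank_of_injective hΦ

/-- Every product lies in the image of the linear output map on `F^t`. For `m > 0` the products
include all multiples of matrix units, so that map is onto the `n × n` matrices. -/
theorem sq_le_rank {n m t : ℕ} (h : HasAlgebraicAlgorithm F n m t) (hm : 0 < m) : n * n ≤ t := by
  classical
  obtain ⟨α, β, lam, h⟩ := h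
  let Ψ : (Fin t → F) →ₗ[F] Matrix (Fin n) (Fin n) F :=
    { toFun := fun w => Matrix.of fun i j => ∑ μ, lam i j μ * w μ
      map_add' := fun v w => by
        ext i j
        simp [mul_add, Finset.sum_add_distrib]
      map_smul' := fun c w => by
        ext i j
        simp only [Matrix.smul_apply, smul_eq_mul, RingHom.id_apply, Pi.smul_apply, Finset.mul_sum,
          Matrix.of_apply]
        exact Finset.sum_congr rfl fun _ _ => by ring }
  have hmem : ∀ (A : Matrix (Fin n) (Fin m) F) (B : Matrix (Fin m) (Fin n) F),
      A * B ∈ LinearMap.range Ψ := by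
    intro A B
    refine ⟨fun μ => (∑ i', ∑ j', α i' j' μ * A i' j') * (∑ i', ∑ j', β i' j' μ * B j' i'), ?_⟩
    ext i j
    rw [h]
    simp [Ψ, mul_assoc]
  have hΨ : Function.Surjective Ψ := by
    rw [← LinearMap.range_eq_top, eq_top_iff]
    intro M _
    rw [Matrix.matrix_eq_sum_single M]
    refine Submodule.sum_mem _ fun i _ => Submodule.sum_mem _ fun j _ => ?_
    have : Matrix.single i j (M i j) =
        Matrix.single i (⟨0, hm⟩ : Fin m) (M i j) * Matrix.single (⟨0, hm⟩ : Fin m) j (1 : F) := by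
      simp
    rw [this]
    exact hmem _ _
  simpa [Module.finrank_matrix] using LinearMap.finrank_le_finrank_of_surjective hΨ

end HasAlgebraicAlgorithm

/-! ### The exponent `ω(γ)` and the balancing equation -/

theorem le_of_forall_rpow_le {a b C : ℝ} (h : ∀ n : ℕ, 1 ≤ n → (n : ℝ) ^ a ≤ C * (n : ℝ) ^ b) :
    a ≤ b := by
  by_contra! hab
  have ht := (tendsto_rpow_atTop (sub_pos.2 hab)).comp tendsto_natCast_atTop_atTop
  obtain ⟨n, hn1, hn2⟩ := ((ht.eventually_gt_atTop C).and (Filter.eventually_ge_atTop 1)).exists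
  have hn0 : (0 : ℝ) < n := by exact_mod_cast hn2
  have h1 := h n hn2
  have h2 : (n : ℝ) ^ a = (n : ℝ) ^ (a - b) * (n : ℝ) ^ b := by
    rw [← Real.rpow_add hn0]; congr 1; ring
  rw [h2] at h1
  have h3 := le_of_mul_le_mul_right h1 (Real.rpow_pos_of_pos hn0 b)
  exact absurd hn1 (not_lt.2 h3)

section Exponent

variable {ι : Type*} (F : ι → Type*) [∀ i, Field (F i)]

/-- Rank `O(n^τ)` suffices for the product of `n × ⌈n^γ⌉` by `⌈n^γ⌉ × n` matrices. -/
def MatMulRankBound (γ τ : ℝ) : Prop :=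
  ∃ C : ℝ, ∀ (i : ι) (n : ℕ), 1 ≤ n →
    ∃ t : ℕ, HasAlgebraicAlgorithm (F i) n ⌈(n : ℝ) ^ γ⌉₊ t ∧ (t : ℝ) ≤ C * (n : ℝ) ^ τ

theorem natCeil_rpow_pos {n : ℕ} (hn : 1 ≤ n) (γ : ℝ) : 0 < ⌈(n : ℝ) ^ γ⌉₊ :=
  Nat.ceil_pos.2 (Real.rpow_pos_of_pos (by exact_mod_cast hn) γ)

theorem natCeil_rpow_le {n : ℕ} (hn : 1 ≤ n) {γ : ℝ} (hγ : 0 ≤ γ) :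
    (⌈(n : ℝ) ^ γ⌉₊ : ℝ) ≤ 2 * (n : ℝ) ^ γ := by
  have h1 : (1 : ℝ) ≤ (n : ℝ) ^ γ := Real.one_le_rpow (by exact_mod_cast hn) hγ
  have h2 := (Nat.ceil_lt_add_one (a := (n : ℝ) ^ γ) (by positivity)).le
  linarith

variable {F}

theorem MatMulRankBound.mono {γ τ τ' : ℝ} (h : MatMulRankBound F γ τ) (hτ : τ ≤ τ') :
    MatMulRankBound F γ τ' := by
  obtain ⟨C, hC⟩ := h
  refine ⟨|C|, fun i n hn => ?_⟩
  obtain ⟨t, ht, htC⟩ := hC i n hn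
  refine ⟨t, ht, htC.trans ?_⟩
  have hn' : (1 : ℝ) ≤ n := by exact_mod_cast hn
  exact mul_le_mul (le_abs_self C) (Real.rpow_le_rpow_of_exponent_le hn' hτ) (by positivity)
    (abs_nonneg C)

theorem MatMulRankBound.two_le [Nonempty ι] {γ τ : ℝ} (h : MatMulRankBound F γ τ) : 2 ≤ τ := by
  obtain ⟨C, hC⟩ := h
  refine le_of_forall_rpow_le (C := C) fun n hn => ?_
  obtain ⟨t, ht, htC⟩ := hC (Classical.arbitrary ι) n hn
  refine le_trans ?_ htC
  have h1 := ht.sq_le_rank (natCeil_rpow_pos hn γ)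
  rw [Real.rpow_two, sq]
  exact_mod_cast h1

theorem MatMulRankBound.one_add_le [Nonempty ι] {γ τ : ℝ} (h : MatMulRankBound F γ τ) :
    1 + γ ≤ τ := by
  obtain ⟨C, hC⟩ := h
  refine le_of_forall_rpow_le (C := C) fun n hn => ?_
  obtain ⟨t, ht, htC⟩ := hC (Classical.arbitrary ι) n hn
  refine le_trans ?_ htC
  have h1 := ht.mul_le_rank
  have hn' : (0 : ℝ) < n := by exact_mod_cast hn
  rw [Real.rpow_add hn', Real.rpow_one]
  calc (n : ℝ) * (n : ℝ) ^ γ ≤ n * ⌈(n : ℝ) ^ γ⌉₊ := by gcongr; exact Nat.le_ceil _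
    _ ≤ t := by exact_mod_cast h1

theorem MatMulRankBound.two_add {γ : ℝ} (hγ : 0 ≤ γ) : MatMulRankBound F γ (2 + γ) := by
  refine ⟨2, fun i n hn => ⟨_, HasAlgebraicAlgorithm.trivial (F i) n _, ?_⟩⟩
  have hn' : (0 : ℝ) < n := by exact_mod_cast hn
  push_cast
  rw [Real.rpow_add hn', Real.rpow_two]
  have := natCeil_rpow_le hn hγ
  calc (n : ℝ) * n * ⌈(n : ℝ) ^ γ⌉₊ ≤ n * n * (2 * (n : ℝ) ^ γ) := by gcongr
    _ = _ := by ring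

theorem matMulExponent_le [Nonempty ι] {γ τ : ℝ}
    (h : ∀ ε : ℝ, 0 < ε → MatMulRankBound F γ (τ + ε)) : matMulExponent F γ ≤ τ := by
  refine csInf_le ⟨1, fun τ' (hτ' : ∀ ε : ℝ, 0 < ε → MatMulRankBound F γ (τ' + ε)) => ?_⟩ h
  have := (hτ' 1 one_pos).two_le
  linarith

/-- The cubic algorithm makes the set in the infimum nonempty, so the infimum can be approached
within `ε / 2`. -/
theorem rankBound_matMulExponent_add {γ ε : ℝ} (hγ : 0 ≤ γ) (hε : 0 < ε) :
    MatMulRankBound F γ (matMulExponent F γ + ε) := by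
  have hne : {τ : ℝ | ∀ ε : ℝ, 0 < ε → MatMulRankBound F γ (τ + ε)}.Nonempty :=
    ⟨2 + γ, fun ε hε => (MatMulRankBound.two_add hγ).mono (by linarith)⟩
  obtain ⟨τ, hτ, hlt⟩ := exists_lt_of_csInf_lt hne
    (show matMulExponent F γ < matMulExponent F γ + ε / 2 by linarith)
  exact (hτ (ε / 2) (by linarith)).mono (by linarith)

theorem two_le_matMulExponent [Nonempty ι] {γ : ℝ} (hγ : 0 ≤ γ) : 2 ≤ matMulExponent F γ :=
  le_of_forall_pos_le_add fun _ hε => (rankBound_matMulExponent_add hγ hε).two_le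

theorem one_add_le_matMulExponent [Nonempty ι] {γ : ℝ} (hγ : 0 ≤ γ) :
    1 + γ ≤ matMulExponent F γ :=
  le_of_forall_pos_le_add fun _ hε => (rankBound_matMulExponent_add hγ hε).one_add_le

theorem matMulExponent_zero [Nonempty ι] : matMulExponent F 0 = 2 := by
  refine le_antisymm (matMulExponent_le fun ε hε => MatMulRankBound.mono (τ := 2) ?_ (by linarith))
    (two_le_matMulExponent le_rfl)
  refine ⟨1, fun i n hn => ⟨n * n, ?_, ?_⟩⟩
  · simpa using HasAlgebraicAlgorithm.outer (F i) n
  · push_cast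
    rw [Real.rpow_two, one_mul, sq]

theorem matMulExponent_mono [Nonempty ι] {γ γ' : ℝ} (hγ : 0 ≤ γ) (h : γ ≤ γ') :
    matMulExponent F γ ≤ matMulExponent F γ' := by
  refine matMulExponent_le fun ε hε => ?_
  obtain ⟨C, hC⟩ := rankBound_matMulExponent_add (F := F) (hγ.trans h) hε
  refine ⟨C, fun i n hn => ?_⟩
  obtain ⟨t, ht, htC⟩ := hC i n hn
  exact ⟨t, ht.of_le (Nat.ceil_mono (Real.rpow_le_rpow_of_exponent_le (by exact_mod_cast hn) h)), htC⟩

/-- Slicing the inner dimension `n^γ'` into about `n^(γ' - γ)` pieces of size `n^γ` multiplies the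
rank by the number of pieces. With monotonicity this makes `ω` 1-Lipschitz. -/
theorem matMulExponent_le_add [Nonempty ι] {γ γ' : ℝ} (hγ : 0 ≤ γ) (h : γ ≤ γ') :
    matMulExponent F γ' ≤ matMulExponent F γ + (γ' - γ) := by
  refine matMulExponent_le fun ε hε => ?_
  obtain ⟨C, hC⟩ := rankBound_matMulExponent_add (F := F) hγ hε
  refine ⟨2 * C, fun i n hn => ?_⟩
  obtain ⟨t, ht, htC⟩ := hC i n hn
  have hn' : (0 : ℝ) < n := by exact_mod_cast hn
  refine ⟨t * ⌈(n : ℝ) ^ (γ' - γ)⌉₊, (ht.mul_inner _).of_le ?_, ?_⟩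
  · refine Nat.ceil_le.2 ?_
    push_cast
    calc (n : ℝ) ^ γ' = (n : ℝ) ^ γ * (n : ℝ) ^ (γ' - γ) := by
          rw [← Real.rpow_add hn']; congr 1; ring
      _ ≤ _ := by gcongr <;> exact Nat.le_ceil _
  · push_cast
    calc (t : ℝ) * ⌈(n : ℝ) ^ (γ' - γ)⌉₊
        ≤ (C * (n : ℝ) ^ (matMulExponent F γ + ε)) * (2 * (n : ℝ) ^ (γ' - γ)) :=
          mul_le_mul htC (natCeil_rpow_le hn (by linarith)) (by positivity)
            ((Nat.cast_nonneg _).trans htC)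
      _ = 2 * C * ((n : ℝ) ^ (matMulExponent F γ + ε) * (n : ℝ) ^ (γ' - γ)) := by ring
      _ = _ := by rw [← Real.rpow_add hn']; congr 2; ring

theorem continuousOn_matMulExponent [Nonempty ι] :
    ContinuousOn (matMulExponent F) (Set.Ici 0) := by
  have : LipschitzOnWith 1 (matMulExponent F) (Set.Ici 0) := by
    refine LipschitzOnWith.of_dist_le_mul fun x hx y hy => ?_
    rw [NNReal.coe_one, one_mul, Real.dist_eq, Real.dist_eq]
    rcases le_total x y with h | h
    · have h1 := matMulExponent_mono (F := F) hx h
      have h2 := matMulExponent_le_add (F := F) hx h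
      rw [abs_sub_comm, abs_sub_comm x, abs_of_nonneg (by linarith), abs_of_nonneg (by linarith)]
      linarith
    · have h1 := matMulExponent_mono (F := F) hy h
      have h2 := matMulExponent_le_add (F := F) hy h
      rw [abs_of_nonneg (by linarith), abs_of_nonneg (by linarith)]
      linarith
  exact this.continuousOn

/-- The balancing equation has exactly one solution. -/
theorem existsUnique_balanced [Nonempty ι] {a b : ℝ} (ha : 0 < a) (hba : b < a) (hab : 0 ≤ a + 2 * b) :
    ∃! γ : ℝ, 0 ≤ γ ∧ a * γ = a + b * matMulExponent F γ := by
  let f : ℝ → ℝ := fun γ => a * γ - b * matMulExponent F γ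
  obtain ⟨δ, hδ, hδa, hδb⟩ : ∃ δ, 0 < δ ∧ δ ≤ a ∧ δ ≤ a - b :=
    ⟨min a (a - b), lt_min ha (by linarith), min_le_left _ _, min_le_right _ _⟩
  -- Since `ω` has slopes in `[0, 1]`, `f` has slope at least `a` if `b ≤ 0` and at least `a - b`
  -- otherwise. So `f` is strictly increasing and unbounded, and it takes the value `a` once because
  -- `f 0 = -2 * b ≤ a`.
  have hf : ∀ x y, 0 ≤ x → x ≤ y → f x + δ * (y - x) ≤ f y := by
    intro x y hx hxy
    have h1 := matMulExponent_mono (F := F) hx hxy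
    have h2 := matMulExponent_le_add (F := F) hx hxy
    simp only [f]
    rcases le_total b 0 with hb | hb <;> nlinarith
  have hf0 : f 0 ≤ a := by
    simp only [f, matMulExponent_zero]
    linarith
  have hcont : ContinuousOn f (Set.Ici 0) :=
    (continuous_const.mul continuous_id).continuousOn.sub
      (continuousOn_const.mul continuousOn_matMulExponent)
  let G : ℝ := (a - f 0) / δ
  have hG : 0 ≤ G := div_nonneg (by linarith) hδ.le
  have hfG : a ≤ f G := by
    have := hf 0 G le_rfl hG
    have h2 : δ * (G - 0) = a - f 0 := by
      simp only [G]; field_simp; ring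
    linarith
  obtain ⟨γ, hγ, hγa⟩ := intermediate_value_Icc hG (hcont.mono Set.Icc_subset_Ici_self) ⟨hf0, hfG⟩
  have hiff : ∀ x, a * x = a + b * matMulExponent F x ↔ f x = a := by
    intro x
    simp only [f]
    constructor <;> intro h <;> linarith
  refine ⟨γ, ⟨hγ.1, (hiff γ).2 hγa⟩, ?_⟩
  rintro y ⟨hy, hya⟩
  rw [hiff] at hya
  rcases le_total y γ with h | h
  · have := hf y γ hy h
    nlinarith
  · have := hf γ y hγ.1 h
    nlinarith

end Exponent

/-! ### Ranges settled by elementary algorithms -/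

theorem exists_rounds_le_of_le_instances (p : Polynomial ℕ) : ∃ K : ℝ, 0 < K ∧
    ∀ (F : Type u) [Field F] [Finite F] (n m k : ℕ), Nat.card F ≤ p.eval n → 1 ≤ n → n ≤ k →
      RoundsMMLe n m k F (K * (k + k * m / n)) := by
  obtain ⟨K, hK, h⟩ := exists_rounds_le_of_algorithm.{u} p
  refine ⟨5 * K, by positivity, fun F _ _ n m k hF hn hnk => ?_⟩
  refine (h F n m k 1 1 1 hF (hn.trans hnk) one_pos hn (HasAlgebraicAlgorithm.outer F 1)
    (fun _ => one_pos) le_sup_right le_rfl le_rfl).mono ?_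
  have hn' : (1 : ℝ) ≤ n := by exact_mod_cast hn
  have hn0 : (0 : ℝ) < n := by linarith
  have hnk' : (n : ℝ) ≤ k := by exact_mod_cast hnk
  have hr : (1 : ℝ) ≤ k / n := by rwa [le_div_iff₀ hn0, one_mul]
  have hrn : (k : ℝ) / n * n = k := div_mul_cancel₀ _ hn0.ne'
  have hm0 : (0 : ℝ) ≤ m := Nat.cast_nonneg _
  rw [mul_assoc 5 K, mul_left_comm]
  refine mul_le_mul_of_nonneg_left ?_ hK.le
  have e1 : (k : ℝ) * m / n = k / n * m := by ring
  rw [e1]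
  simp only [Nat.cast_one, mul_one, div_one]
  generalize (k : ℝ) / n = r at *
  have h1 : (r + 1) * (m + n + 1) ≤ (2 * r) * (m + n + n) :=
    mul_le_mul (by linarith) (by linarith) (by positivity) (by linarith)
  have h2 : (2 * r) * (m + n + n) = 2 * (r * m) + 4 * (r * n) := by ring
  have h3 : 0 ≤ r * m := by positivity
  linarith

theorem exists_rounds_le_of_inner_le_sqrt (p : Polynomial ℕ) : ∃ K : ℝ, 0 < K ∧
    ∀ (F : Type u) [Field F] [Finite F] (n m k : ℕ), Nat.card F ≤ p.eval n → 1 ≤ k → k ≤ n →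
      (m : ℝ) ≤ √((k : ℝ) * n) → RoundsMMLe n m k F (K * k) := by
  obtain ⟨K, hK, h⟩ := exists_rounds_le_of_algorithm.{u} p
  refine ⟨16 * K, by positivity, fun F _ _ n m k hF hk hkn hm => ?_⟩
  have hq1 : 1 ≤ n / k := (Nat.one_le_div_iff hk).2 hkn
  -- Outer products of rank `d²` with `k * d² ≤ n ≤ 4 * k * d²`: the product nodes stay balanced, `n
  -- / d² ≤ 4 * k`, and `m² ≤ k * n` gives `m / d ≤ 2 * k`.
  obtain ⟨d, hd⟩ : ∃ d, d = Nat.sqrt (n / k) := ⟨_, rfl⟩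
  have hd1 : 1 ≤ d := by rw [hd]; exact Nat.le_sqrt.2 (by omega)
  have hdd : d * d ≤ n / k := by rw [hd]; exact Nat.sqrt_le _
  have hlt : n / k < (d + 1) * (d + 1) := by rw [hd]; exact Nat.lt_succ_sqrt _
  have hkdd : k * (d * d) ≤ n := by
    rw [mul_comm]; exact (Nat.le_div_iff_mul_le hk).1 hdd
  have hn4 : n ≤ 4 * k * (d * d) := by
    have h1 : n < (d + 1) * (d + 1) * k := (Nat.div_lt_iff_lt_mul hk).1 hlt
    have h2 : (d + 1) * (d + 1) ≤ 4 * (d * d) := by nlinarith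
    calc n ≤ (d + 1) * (d + 1) * k := h1.le
      _ ≤ 4 * (d * d) * k := Nat.mul_le_mul_right _ h2
      _ = _ := by ring
  have hdn : d ≤ n := by nlinarith
  refine (h F n m k d 1 (d * d) hF hk hd1 hdn (HasAlgebraicAlgorithm.outer F d)
    (fun _ => one_pos) le_sup_right le_rfl (by nlinarith)).mono ?_
  have hk' : (1 : ℝ) ≤ k := by exact_mod_cast hk
  have hkn' : (k : ℝ) ≤ n := by exact_mod_cast hkn
  have hn0 : (0 : ℝ) < n := by linarith
  have hd' : (0 : ℝ) < d := by exact_mod_cast hd1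
  have hn4' : (n : ℝ) ≤ 4 * k * (d * d) := by exact_mod_cast hn4
  have hkdd' : (k : ℝ) * (d * d) ≤ n := by exact_mod_cast hkdd
  have hm0 : (0 : ℝ) ≤ m := Nat.cast_nonneg _
  have hmm : (m : ℝ) * m ≤ k * n := by
    have := mul_self_le_mul_self hm0 hm
    rwa [Real.mul_self_sqrt (by positivity)] at this
  have hmn : (m : ℝ) ≤ n := by nlinarith
  have h1 : (k : ℝ) * ((d * d : ℕ) : ℝ) / n ≤ 1 := by
    rw [div_le_one hn0]; exact_mod_cast hkdd
  have h2 : (m : ℝ) / d ≤ 2 * k := by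
    rw [div_le_iff₀ hd']
    refine abs_le_of_sq_le_sq' ?_ (by positivity) |>.2
    nlinarith
  have h3 : (n : ℝ) / (d * d) ≤ 4 * k := by
    rw [div_le_iff₀ (by positivity)]
    exact hn4'
  have h4 : (k : ℝ) * m / n ≤ k := by
    rw [div_le_iff₀ hn0]
    nlinarith
  rw [mul_comm 16 K, mul_assoc]
  refine mul_le_mul_of_nonneg_left ?_ hK.le
  simp only [Nat.cast_one, mul_one]
  have h5 : ((k : ℝ) * ((d * d : ℕ) : ℝ) / n + 1) * (m / d + n / (d * d) + 1) ≤
      2 * (2 * k + 4 * k + k) :=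
    mul_le_mul (by linarith) (by linarith) (by positivity) (by norm_num)
  linarith

/-- Inner products of length `e ≈ n / k`, with `d = 1`. Besides the range `m ≥ n² / k`, this covers
the balanced range when the target bound is at least of order `n`. -/
theorem exists_rounds_le_of_vertex_algorithm (p : Polynomial ℕ) : ∃ K : ℝ, 0 < K ∧
    ∀ (F : Type u) [Field F] [Finite F] (n m k : ℕ), Nat.card F ≤ p.eval n → 1 ≤ k → k ≤ n →
      RoundsMMLe n m k F (K * (n + k * m / n)) := by
  obtain ⟨K, hK, h⟩ := exists_rounds_le_of_algorithm.{u} p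
  refine ⟨9 * K, by positivity, fun F _ _ n m k hF hk hkn => ?_⟩
  have hq1 : 1 ≤ n / k := (Nat.one_le_div_iff hk).2 hkn
  obtain ⟨e, he⟩ : ∃ e, e = min (m ⊔ 1) (n / k) := ⟨_, rfl⟩
  have he1 : 1 ≤ e := by rw [he]; exact le_min le_sup_right hq1
  have hek : k * e ≤ n := by
    rw [mul_comm]
    exact (Nat.le_div_iff_mul_le hk).1 (by rw [he]; exact min_le_right _ _)
  refine (h F n m k 1 e e hF hk one_pos (hk.trans hkn)
    (by simpa using HasAlgebraicAlgorithm.trivial F 1 e)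
    (fun _ => he1) (by rw [he]; exact min_le_left _ _) he1 (by omega)).mono ?_
  have hk' : (1 : ℝ) ≤ k := by exact_mod_cast hk
  have hkn' : (k : ℝ) ≤ n := by exact_mod_cast hkn
  have hn0 : (0 : ℝ) < n := by linarith
  have he' : (0 : ℝ) < e := by exact_mod_cast he1
  have hm0 : (0 : ℝ) ≤ m := Nat.cast_nonneg _
  have hQ0 : 0 ≤ (k : ℝ) * m / n := by positivity
  have h1 : (k : ℝ) * e / n ≤ 1 := by
    rw [div_le_one hn0]; exact_mod_cast hek
  have h2 : (m : ℝ) / e ≤ 1 + 2 * (k * m / n) := by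
    rcases le_total (m ⊔ 1) (n / k) with hle | hle
    · rw [min_eq_left hle] at he
      have : (m : ℝ) / e ≤ 1 := by
        rw [div_le_one he']
        exact_mod_cast (by rw [he]; exact le_sup_left : m ≤ e)
      linarith
    · rw [min_eq_right hle] at he
      have h3 : n < (e + 1) * k := by
        rw [he]; exact (Nat.div_lt_iff_lt_mul hk).1 (Nat.lt_succ_self _)
      have h4 : n ≤ 2 * k * e := by nlinarith
      have h5 : (n : ℝ) ≤ 2 * k * e := by exact_mod_cast h4
      have : (m : ℝ) / e ≤ 2 * (k * m / n) := by
        rw [div_le_iff₀ he', ← mul_div_assoc, div_mul_eq_mul_div, le_div_iff₀ hn0]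
        nlinarith
      linarith
  rw [mul_comm 9 K, mul_assoc]
  refine mul_le_mul_of_nonneg_left ?_ hK.le
  simp only [Nat.cast_one, mul_one, one_mul, div_one]
  have h5 : ((k : ℝ) * e / n + 1) * (m / e + n + 1) ≤ 2 * ((1 + 2 * (k * m / n)) + n + 1) :=
    mul_le_mul (by linarith) (by linarith) (by positivity) (by norm_num)
  linarith

/-! ### The balanced range -/

section Exponent

variable {ι : Type*} [Nonempty ι] (F : ι → Type*) [∀ i, Field (F i)]

/-- The implied constants can be chosen uniformly for bounded `γ`. -/
theorem exists_uniform_rank_bound (Γ : ℝ) {η : ℝ} (hη : 0 < η) : ∃ C : ℝ, 1 ≤ C ∧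
    ∀ (γ : ℝ) (i : ι) (n e : ℕ), 0 ≤ γ → γ ≤ Γ → 1 ≤ n → e ≤ ⌈(n : ℝ) ^ γ⌉₊ →
      ∃ t : ℕ, HasAlgebraicAlgorithm (F i) n e t ∧
        (t : ℝ) ≤ C * (n : ℝ) ^ (matMulExponent F γ + η) := by
  have hη2 : 0 < η / 2 := by linarith
  -- Only grid exponents `j * (η / 2)` get constants of their own. Rounding `γ` up to the grid costs
  -- at most `η / 2` in `ω`, and for `γ ≤ Γ` finitely many `j` occur, so their constants can be
  -- summed.
  choose C hC using fun j : ℕ =>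
    rankBound_matMulExponent_add (F := F) (γ := j * (η / 2)) (by positivity) hη2
  refine ⟨1 + ∑ j ∈ Finset.range (⌈Γ / (η / 2)⌉₊ + 1), |C j|, ?_, ?_⟩
  · have : 0 ≤ ∑ j ∈ Finset.range (⌈Γ / (η / 2)⌉₊ + 1), |C j| :=
      Finset.sum_nonneg fun _ _ => abs_nonneg _
    linarith
  · intro γ i n e hγ hγΓ hn he
    obtain ⟨j, hj⟩ : ∃ j, j = ⌈γ / (η / 2)⌉₊ := ⟨_, rfl⟩
    have hj1 : γ ≤ j * (η / 2) := by
      rw [← div_le_iff₀ hη2, hj]; exact Nat.le_ceil _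
    have hj2 : j * (η / 2) ≤ γ + η / 2 := by
      have := (Nat.ceil_lt_add_one (a := γ / (η / 2)) (by positivity)).le
      rw [← hj, ← sub_le_iff_le_add, le_div_iff₀ hη2] at this
      linarith
    have hjmem : j ∈ Finset.range (⌈Γ / (η / 2)⌉₊ + 1) := by
      rw [Finset.mem_range, Nat.lt_succ_iff, hj]
      exact Nat.ceil_mono (by gcongr)
    have hn' : (1 : ℝ) ≤ n := by exact_mod_cast hn
    obtain ⟨t, ht, htC⟩ := hC j i n hn
    refine ⟨t, ht.of_le (he.trans (Nat.ceil_mono (Real.rpow_le_rpow_of_exponent_le hn' hj1))), ?_⟩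
    refine htC.trans (mul_le_mul ?_ (Real.rpow_le_rpow_of_exponent_le hn' ?_) (by positivity) ?_)
    · have := Finset.single_le_sum (f := fun j => |C j|) (fun _ _ => abs_nonneg _) hjmem
      have h2 := le_abs_self (C j)
      linarith
    · have := matMulExponent_le_add (F := F) hγ hj1
      linarith
    · have : 0 ≤ ∑ j ∈ Finset.range (⌈Γ / (η / 2)⌉₊ + 1), |C j| :=
        Finset.sum_nonneg fun _ _ => abs_nonneg _
      linarith

/-- For `k = n` the range would read `k ≤ m < k`. Hence `log n > 0` and `n / k > 1` throughout the
range. -/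
theorem lt_of_balanced_range {n m k : ℕ} (hk : 1 ≤ k) (hkn : k ≤ n) (h1 : √((k : ℝ) * n) ≤ m)
    (h2 : (m : ℝ) < (n : ℝ) ^ 2 / k) : k < n := by
  refine lt_of_le_of_ne hkn fun h => ?_
  subst h
  have hk' : (0 : ℝ) < k := by exact_mod_cast hk
  rw [Real.sqrt_mul_self hk'.le] at h1
  have : (k : ℝ) ^ 2 / k = k := by field_simp
  linarith

theorem existsUnique_isBalancedExponent {n m k : ℕ} (hk : 1 ≤ k) (hkn : k ≤ n)
    (h1 : √((k : ℝ) * n) ≤ m) (h2 : (m : ℝ) < (n : ℝ) ^ 2 / k) :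
    ∃! γ : ℝ, IsBalancedExponent F n m k γ := by
  have hlt := lt_of_balanced_range hk hkn h1 h2
  have hk' : (0 : ℝ) < k := by exact_mod_cast hk
  have hlt' : (k : ℝ) < n := by exact_mod_cast hlt
  have hn' : (1 : ℝ) < n := by exact_mod_cast (by omega : 1 < n)
  have hm' : (0 : ℝ) < m := lt_of_lt_of_le (Real.sqrt_pos.2 (by positivity)) h1
  have hL : 0 < Real.log n := Real.log_pos hn'
  have e1 : Real.log k < Real.log n := Real.log_lt_log hk' hlt'
  have e2 : Real.log m + Real.log k < 2 * Real.log n := by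
    rw [lt_div_iff₀ hk'] at h2
    have := Real.log_lt_log (by positivity) h2
    rw [Real.log_mul hm'.ne' hk'.ne', Real.log_pow] at this
    exact_mod_cast this
  have e3 : Real.log k + Real.log n ≤ 2 * Real.log m := by
    have h3 : (k : ℝ) * n ≤ (m : ℝ) ^ 2 := (Real.sqrt_le_left hm'.le).1 h1
    have := Real.log_le_log (by positivity) h3
    rw [Real.log_mul hk'.ne' (by positivity), Real.log_pow] at this
    exact_mod_cast this
  -- The three conditions on the coefficients are, after taking logarithms, `k < n`, `m < n² / k`
  -- and `√(kn) ≤ m`.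
  refine existsUnique_balanced ?_ ?_ ?_
  · rw [sub_pos, div_lt_one hL]; exact e1
  · have : Real.log m / Real.log n + Real.log k / Real.log n < 2 := by
      rw [← add_div, div_lt_iff₀ hL]; exact e2
    linarith
  · have : Real.log k / Real.log n + 1 ≤ 2 * (Real.log m / Real.log n) := by
      rw [← mul_div_assoc, le_div_iff₀ hL, add_mul, div_mul_cancel₀ _ hL.ne', one_mul]
      exact e3
    linarith

variable {F} in
-- The exponentiated equation. If `d^ω = n / k` it reads `m = n * d^(γ - 1)`, that is, `m / d^(1 +
-- γ) = n / d²`.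
theorem IsBalancedExponent.inner_eq {n m k : ℕ} {γ : ℝ} (h : IsBalancedExponent F n m k γ)
    (hk : 1 ≤ k) (hkn : k < n) (hm : 1 ≤ m) :
    (m : ℝ) = n * ((n : ℝ) / k) ^ ((γ - 1) / matMulExponent F γ) := by
  obtain ⟨hγ, h⟩ := h
  have hω := two_le_matMulExponent (F := F) hγ
  have hk' : (0 : ℝ) < k := by exact_mod_cast hk
  have hm' : (0 : ℝ) < m := by exact_mod_cast hm
  have hn' : (1 : ℝ) < n := by exact_mod_cast (by omega : 1 < n)
  have hn0 : (0 : ℝ) < n := by linarith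
  have hL : 0 < Real.log n := Real.log_pos hn'
  refine Real.log_injOn_pos hm' (Set.mem_Ioi.2 (by positivity)) ?_
  rw [Real.log_mul hn0.ne' (by positivity), Real.log_rpow (by positivity),
    Real.log_div hn0.ne' hk'.ne']
  have hω0 : matMulExponent F γ ≠ 0 := by linarith
  field_simp at h ⊢
  linarith

theorem rpow_mul_rpow_one_sub_mul {n k a ε : ℝ} (hn : 0 < n) (hk : 0 < k) :
    k ^ a * n ^ (1 - a) * (n / k) ^ ε = n * (n / k) ^ (ε - a) := by
  rw [Real.rpow_sub (div_pos hn hk), Real.div_rpow hn.le hk.le a, Real.rpow_sub hn, Real.rpow_one]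
  field_simp

/-- `d` is the floor of `(N / C)^(1 / s)`, the largest block number whose rank bound `C * d^s` stays
within `N`. The floor costs a factor `2^a`, and `C^(a / s) ≤ C` because `a ≤ s`. -/
theorem exists_nat_rpow_bounds {N C s : ℝ} (hC : 1 ≤ C) (hNC : C ≤ N) (hs : 0 < s) :
    ∃ d : ℕ, 1 ≤ d ∧ C * (d : ℝ) ^ s ≤ N ∧
      ∀ a : ℝ, 0 ≤ a → a ≤ s → 1 / (d : ℝ) ^ a ≤ 2 ^ a * (C * N ^ (-(a / s))) := by
  have hC0 : 0 < C := by linarith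
  have hN0 : 0 < N := by linarith
  obtain ⟨x, hx⟩ : ∃ x, x = (N / C) ^ (1 / s) := ⟨_, rfl⟩
  have hx1 : 1 ≤ x := by
    rw [hx]
    exact Real.one_le_rpow (by rwa [one_le_div hC0]) (by positivity)
  have hx0 : 0 < x := by linarith
  have hxa : ∀ a, x ^ a = (N / C) ^ (a / s) := by
    intro a
    rw [hx, ← Real.rpow_mul (by positivity), one_div_mul_eq_div]
  have hd1 : 1 ≤ ⌊x⌋₊ := Nat.le_floor (by simpa using hx1)
  have hd1' : (1 : ℝ) ≤ (⌊x⌋₊ : ℝ) := by exact_mod_cast hd1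
  have hxd : x ≤ 2 * (⌊x⌋₊ : ℝ) := by
    have := (Nat.lt_floor_add_one x).le
    linarith
  refine ⟨⌊x⌋₊, hd1, ?_, fun a ha has => ?_⟩
  · calc C * (⌊x⌋₊ : ℝ) ^ s ≤ C * x ^ s := by gcongr; exact Nat.floor_le hx0.le
      _ = N := by rw [hxa, div_self hs.ne', Real.rpow_one]; field_simp
  · have h1 : x ^ a ≤ 2 ^ a * (⌊x⌋₊ : ℝ) ^ a := by
      rw [← Real.mul_rpow (by norm_num) (by positivity)]
      gcongr
    have h2 : 1 / (⌊x⌋₊ : ℝ) ^ a ≤ 2 ^ a * x ^ (-a) := by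
      rw [Real.rpow_neg hx0.le, ← div_eq_mul_inv, div_le_div_iff₀ (by positivity)
        (by positivity), one_mul]
      exact h1
    refine h2.trans ?_
    gcongr
    rw [hxa, neg_div, Real.div_rpow hN0.le hC0.le, Real.rpow_neg hC0.le, div_inv_eq_mul, mul_comm]
    refine mul_le_mul_of_nonneg_right ?_ (by positivity)
    calc C ^ (a / s) ≤ C ^ (1 : ℝ) :=
          Real.rpow_le_rpow_of_exponent_le hC (by rwa [div_le_one hs])
      _ = C := Real.rpow_one C

/-- Replacing `ω` by `ω + ε` in the rank bound costs at most `ε` in the exponent of `n / k`, so one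
`ε` serves both purposes. -/
theorem div_sub_div_add_le {ω ε a : ℝ} (hω : 1 ≤ ω) (hε : 0 < ε) (haω : a ≤ ω) :
    a / ω - a / (ω + ε) ≤ ε := by
  have hω0 : 0 < ω := by linarith
  have hs0 : 0 < ω + ε := by linarith
  have h4 : a / ω - a / (ω + ε) = (a / ω) * (ε / (ω + ε)) := by
    field_simp
    ring
  rw [h4]
  have h5 : a / ω ≤ 1 := by rwa [div_le_one hω0]
  have h6 : ε / (ω + ε) ≤ ε := div_le_self hε.le (by linarith)
  have h7 : 0 ≤ ε / (ω + ε) := by positivity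
  nlinarith

theorem inner_block_le {n m d e N C γ Γ ω ε : ℝ} (hn : 0 < n) (hm : 0 < m) (hd : 0 < d)
    (hde : d ^ γ ≤ e) (hN : 1 ≤ N) (hC : 0 < C) (hγ : 0 ≤ γ) (hγΓ : γ ≤ Γ) (hω : 1 + γ ≤ ω) (hε : 0 < ε)
    (hmN : m = n * N ^ ((γ - 1) / ω))
    (hdN : 1 / d ^ (1 + γ) ≤ 2 ^ (1 + γ) * (C * N ^ (-((1 + γ) / (ω + ε))))) :
    m / (d * e) ≤ 2 ^ (1 + Γ) * (n * (C * N ^ (ε - 2 / ω))) := by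
  have hN0 : 0 < N := by linarith
  have hexp : (γ - 1) / ω + -((1 + γ) / (ω + ε)) ≤ ε - 2 / ω := by
    have h3 := div_sub_div_add_le (by linarith) hε hω
    have h8 : (γ - 1) / ω = (1 + γ) / ω - 2 / ω := by ring
    linarith
  have h1 : d ^ (1 + γ) ≤ d * e := by
    rw [Real.rpow_add hd, Real.rpow_one]
    gcongr
  calc m / (d * e) ≤ m / d ^ (1 + γ) := by gcongr
    _ = m * (1 / d ^ (1 + γ)) := by ring
    _ ≤ m * (2 ^ (1 + γ) * (C * N ^ (-((1 + γ) / (ω + ε))))) := by gcongr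
    _ = 2 ^ (1 + γ) * (n * (C * (N ^ ((γ - 1) / ω) * N ^ (-((1 + γ) / (ω + ε)))))) := by
        rw [hmN]; ring
    _ ≤ 2 ^ (1 + Γ) * (n * (C * N ^ (ε - 2 / ω))) := by
        rw [← Real.rpow_add hN0]
        have h2 : N ^ ((γ - 1) / ω + -((1 + γ) / (ω + ε))) ≤ N ^ (ε - 2 / ω) :=
          Real.rpow_le_rpow_of_exponent_le hN hexp
        have h3 : (2 : ℝ) ^ (1 + γ) ≤ 2 ^ (1 + Γ) :=
          Real.rpow_le_rpow_of_exponent_le (by norm_num) (by linarith)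
        gcongr

theorem outer_block_le {n d N C ω ε : ℝ} (hn : 0 < n) (hN : 1 ≤ N) (hC : 0 < C)
    (hω : 2 ≤ ω) (hε : 0 < ε)
    (hdN : 1 / d ^ (2 : ℝ) ≤ 2 ^ (2 : ℝ) * (C * N ^ (-(2 / (ω + ε))))) :
    n / (d * d) ≤ 4 * (n * (C * N ^ (ε - 2 / ω))) := by
  have h3 := div_sub_div_add_le (by linarith) hε hω
  have h2 : N ^ (-(2 / (ω + ε))) ≤ N ^ (ε - 2 / ω) :=
    Real.rpow_le_rpow_of_exponent_le hN (by linarith)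
  rw [Real.rpow_two, Real.rpow_two, sq d] at hdN
  calc n / (d * d) = n * (1 / (d * d)) := by ring
    _ ≤ n * (2 ^ 2 * (C * N ^ (-(2 / (ω + ε))))) := by gcongr
    _ ≤ n * (2 ^ 2 * (C * N ^ (ε - 2 / ω))) := by gcongr
    _ = _ := by ring

theorem round_count_le {ρ X Y Q P Z k : ℝ} (hρ : ρ ≤ 2) (hX0 : 0 ≤ X) (hk : 1 ≤ k) (hkY : k ≤ Y)
    (hQX : Q ≤ X) (hX : X ≤ 1 + P * Z) (hY : Y ≤ 4 * Z) :
    ρ * (X + Y + 1) + k + Q ≤ 3 * (1 + P) * Z + 32 * Z := by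
  have h3 : ρ * (X + Y + 1) ≤ 2 * (X + Y + 1) := mul_le_mul_of_nonneg_right hρ (by linarith)
  linarith

set_option maxHeartbeats 1000000 in
theorem exists_rounds_le_of_isBalancedExponent [∀ i, Finite (F i)] (p : Polynomial ℕ) {ε : ℝ}
    (hε : 0 < ε) : ∃ C : ℝ, ∀ (i : ι) (n m k : ℕ), Nat.card (F i) ≤ p.eval n → 1 ≤ k → k ≤ n →
      √((k : ℝ) * n) ≤ m → (m : ℝ) < (n : ℝ) ^ 2 / k →
      ∀ γ : ℝ, IsBalancedExponent F n m k γ →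
        RoundsMMLe n m k (F i)
          (C * ((k : ℝ) ^ (2 / matMulExponent F γ) * (n : ℝ) ^ (1 - 2 / matMulExponent F γ) *
            ((n : ℝ) / k) ^ ε)) := by
  obtain ⟨K, hK, hround⟩ := exists_rounds_le_of_algorithm p
  obtain ⟨K', hK', hround'⟩ := exists_rounds_le_of_vertex_algorithm p
  -- The bound `2 / ε` on `γ` is enough: either `2 / ω ≤ ε` and the target is at least of order `n`,
  -- or `γ ≤ ω - 1 < 2 / ε`.
  obtain ⟨C, hC, hrank⟩ := exists_uniform_rank_bound F (2 / ε) hε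
  have hC0 : 0 < C := by linarith
  refine ⟨2 * K' * C + K * (3 * (1 + 2 ^ (1 + 2 / ε)) * C + 32 * C), ?_⟩
  intro i n m k hF hk hkn h1 h2 γ hγ
  have hlt := lt_of_balanced_range hk hkn h1 h2
  have hk' : (1 : ℝ) ≤ k := by exact_mod_cast hk
  have hk0 : (0 : ℝ) < k := by linarith
  have hlt' : (k : ℝ) < n := by exact_mod_cast hlt
  have hn' : (1 : ℝ) < n := by linarith
  have hn0 : (0 : ℝ) < n := by linarith
  have hm0 : (0 : ℝ) < m := lt_of_lt_of_le (Real.sqrt_pos.2 (by positivity)) h1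
  have hm1 : 1 ≤ m := by exact_mod_cast hm0
  have hmN := hγ.inner_eq hk hlt hm1
  have hγ0 := hγ.1
  have hω2 := two_le_matMulExponent (F := F) hγ0
  have hωγ := one_add_le_matMulExponent (F := F) hγ0
  rw [rpow_mul_rpow_one_sub_mul hn0 hk0]
  have hrankγ := hrank γ i
  generalize matMulExponent F γ = ω at *
  obtain ⟨N, hN⟩ : ∃ N : ℝ, N = n / k := ⟨_, rfl⟩
  rw [← hN] at hmN ⊢
  have hN1 : 1 < N := by rwa [hN, one_lt_div hk0]
  have hN0 : 0 < N := by linarith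
  have hNk : N * k = n := by rw [hN, div_mul_cancel₀ _ hk0.ne']
  have hω0 : 0 < ω := by linarith
  have hpos : 0 < n * N ^ (ε - 2 / ω) := by positivity
  -- If the target is at least of order `n`, inner products suffice, since `k * m / n ≤ n` here.
  -- This disposes of `2 / ω ≤ ε` and of `N < C`, where no admissible `d` is guaranteed.
  have htriv : 1 ≤ C * N ^ (ε - 2 / ω) → RoundsMMLe n m k (F i)
      ((2 * K' * C + K * (3 * (1 + 2 ^ (1 + 2 / ε)) * C + 32 * C)) * (n * N ^ (ε - 2 / ω))) := by
    intro hle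
    refine (hround' (F i) n m k hF hk hkn).mono ?_
    have h3 : (k : ℝ) * m / n ≤ n := by
      rw [div_le_iff₀ hn0]
      rw [lt_div_iff₀ hk0] at h2
      nlinarith
    have h4 : K' * (n + k * m / n) ≤ (2 * K' * C) * (n * N ^ (ε - 2 / ω)) := by
      calc K' * (n + k * m / n) ≤ K' * (n + n) := by gcongr
        _ = 2 * K' * n * 1 := by ring
        _ ≤ 2 * K' * n * (C * N ^ (ε - 2 / ω)) := by gcongr
        _ = _ := by ring
    refine h4.trans (mul_le_mul_of_nonneg_right ?_ hpos.le)
    have : 0 ≤ K * (3 * (1 + 2 ^ (1 + 2 / ε)) * C + 32 * C) := by positivity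
    linarith
  by_cases hεω : 2 / ω ≤ ε
  · refine htriv ?_
    have : 1 ≤ N ^ (ε - 2 / ω) := Real.one_le_rpow hN1.le (by linarith)
    nlinarith
  push Not at hεω
  by_cases hNC : N < C
  · refine htriv ?_
    have h3 : N ^ (-1 : ℝ) ≤ N ^ (ε - 2 / ω) := by
      refine Real.rpow_le_rpow_of_exponent_le hN1.le ?_
      have : 2 / ω ≤ 1 := by rwa [div_le_one hω0]
      linarith
    calc (1 : ℝ) = N * N ^ (-1 : ℝ) := by rw [Real.rpow_neg_one, mul_inv_cancel₀ hN0.ne']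
      _ ≤ C * N ^ (ε - 2 / ω) := by gcongr
  push Not at hNC
  have hωε : ω ≤ 2 / ε := by
    rw [lt_div_iff₀ hω0] at hεω
    rw [le_div_iff₀ hε]
    linarith
  obtain ⟨d, hd1, hdN, hda⟩ := exists_nat_rpow_bounds hC hNC (by linarith : 0 < ω + ε)
  have hd1' : (1 : ℝ) ≤ d := by exact_mod_cast hd1
  have hd0' : (0 : ℝ) < d := by linarith
  -- The minimum keeps `e ≤ m`; when it equals `m`, the term `m / (d * e)` is at most `1`.
  obtain ⟨e, he⟩ : ∃ e, e = min m ⌈(d : ℝ) ^ γ⌉₊ := ⟨_, rfl⟩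
  have he1 : 1 ≤ e := by rw [he]; exact le_min hm1 (natCeil_rpow_pos hd1 γ)
  have he0' : (0 : ℝ) < e := by exact_mod_cast he1
  obtain ⟨t, ht, htC⟩ := hrankγ d e hγ0 (by linarith) hd1 (by rw [he]; exact min_le_right _ _)
  have htN : (t : ℝ) ≤ N := htC.trans hdN
  have hkt : (k : ℝ) * t ≤ n := by
    rw [← hNk, mul_comm N]
    gcongr
  have hdt := ht.sq_le_rank he1
  have hdet := ht.mul_le_rank
  have hdt' : (d : ℝ) * d ≤ t := by exact_mod_cast hdt
  have hdet' : (d : ℝ) * e ≤ t := by exact_mod_cast hdet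
  have hdn : d ≤ n := by
    have : (d : ℝ) ≤ n := by
      calc (d : ℝ) ≤ d * d := le_mul_of_one_le_left hd0'.le hd1'
        _ ≤ t := hdt'
        _ ≤ k * t := le_mul_of_one_le_left (Nat.cast_nonneg _) hk'
        _ ≤ n := hkt
    exact_mod_cast this
  refine (hround (F i) n m k d e t hF hk hd1 hdn ht (fun _ => he1)
    (by rw [he]; exact (min_le_left _ _).trans le_sup_left) hdt hdet).mono ?_
  have hX : (m : ℝ) / (d * e) ≤ 1 + 2 ^ (1 + 2 / ε) * (n * (C * N ^ (ε - 2 / ω))) := by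
    have hnn : 0 ≤ 2 ^ (1 + 2 / ε) * (n * (C * N ^ (ε - 2 / ω))) := by positivity
    rcases le_total m ⌈(d : ℝ) ^ γ⌉₊ with hle | hle
    · rw [min_eq_left hle] at he
      have : (m : ℝ) / (d * e) ≤ 1 := by
        rw [div_le_one (by positivity), he]
        exact le_mul_of_one_le_left hm0.le hd1'
      linarith
    · rw [min_eq_right hle] at he
      have := inner_block_le (e := (e : ℝ)) hn0 hm0 hd0' (by rw [he]; exact Nat.le_ceil _) hN1.le hC0 hγ0
        (by linarith : γ ≤ 2 / ε) hωγ hε hmN (hda _ (by linarith) (by linarith))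
      linarith
  have hY : (n : ℝ) / (d * d) ≤ 4 * (n * (C * N ^ (ε - 2 / ω))) :=
    outer_block_le hn0 hN1.le hC0 hω2 hε (hda _ (by norm_num) (by linarith))
  have hkY : (k : ℝ) ≤ n / (d * d) := by
    rw [le_div_iff₀ (by positivity)]
    exact (mul_le_mul_of_nonneg_left hdt' hk0.le).trans hkt
  have hkX : (k : ℝ) * m / n ≤ m / (d * e) := by
    rw [div_le_div_iff₀ hn0 (by positivity)]
    calc (k : ℝ) * m * (d * e) = m * (k * (d * e)) := by ring
      _ ≤ m * (k * t) := by gcongr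
      _ ≤ m * n := by gcongr
  have hρ : (k : ℝ) * t / n + 1 ≤ 2 := by
    have : (k : ℝ) * t / n ≤ 1 := by rwa [div_le_one hn0]
    linarith
  have hZ : 0 ≤ n * (C * N ^ (ε - 2 / ω)) := by positivity
  obtain ⟨Z, hZe⟩ : ∃ Z, Z = n * (C * N ^ (ε - 2 / ω)) := ⟨_, rfl⟩
  have hsplit : (2 * K' * C + K * (3 * (1 + 2 ^ (1 + 2 / ε)) * C + 32 * C)) * (n * N ^ (ε - 2 / ω)) =
      2 * K' * Z + K * (3 * (1 + 2 ^ (1 + 2 / ε)) * Z + 32 * Z) := by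
    rw [hZe]; ring
  rw [hsplit]
  rw [← hZe] at hX hY hZ
  have h5 := mul_le_mul_of_nonneg_left
    (round_count_le hρ (by positivity) hk' hkY hkX hX hY) hK.le
  have h6 : 0 ≤ 2 * K' * Z := by positivity
  linarith

end Exponent

/-! ### Assembly of the ranges -/

theorem theorem1 {ι : Type*} [Nonempty ι] (F : ι → Type*) [∀ i, Field (F i)] [∀ i, Finite (F i)]
    (p : Polynomial ℕ) :
    -- `1 ≤ k ≤ n`, `0 ≤ m ≤ √(kn)`: `O(k)` rounds
    (∃ C : ℝ, ∀ (i : ι) (n m k : ℕ), Nat.card (F i) ≤ p.eval n → 1 ≤ k → k ≤ n →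
      (m : ℝ) ≤ √((k : ℝ) * n) →
      RoundsMMLe n m k (F i) (C * k)) ∧
    -- `1 ≤ k ≤ n`, `√(kn) ≤ m < n² / k`: the equation for `γ` has exactly one solution
    (∀ n m k : ℕ, 1 ≤ k → k ≤ n → √((k : ℝ) * n) ≤ m → (m : ℝ) < (n : ℝ) ^ 2 / k →
      ∃! γ : ℝ, IsBalancedExponent F n m k γ) ∧
    -- and `O(k^{2/ω(γ)} n^{1-2/ω(γ)})` rounds suffice, up to `o(1)` in the exponent
    (∀ ε : ℝ, 0 < ε → ∃ C : ℝ, ∀ (i : ι) (n m k : ℕ), Nat.card (F i) ≤ p.eval n → 1 ≤ k → k ≤ n →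
      √((k : ℝ) * n) ≤ m → (m : ℝ) < (n : ℝ) ^ 2 / k →
      ∀ γ : ℝ, IsBalancedExponent F n m k γ →
        RoundsMMLe n m k (F i)
          (C * ((k : ℝ) ^ (2 / matMulExponent F γ) * (n : ℝ) ^ (1 - 2 / matMulExponent F γ) *
            ((n : ℝ) / k) ^ ε))) ∧
    -- `1 ≤ k ≤ n`, `m ≥ n² / k`: `O(km/n)` rounds
    (∃ C : ℝ, ∀ (i : ι) (n m k : ℕ), Nat.card (F i) ≤ p.eval n → 1 ≤ k → k ≤ n →
      (n : ℝ) ^ 2 / k ≤ m →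
      RoundsMMLe n m k (F i) (C * ((k : ℝ) * m / n))) ∧
    -- `k ≥ n`, `1 ≤ m ≤ n`: `O(k)` rounds
    (∃ C : ℝ, ∀ (i : ι) (n m k : ℕ), Nat.card (F i) ≤ p.eval n → 1 ≤ n → n ≤ k →
      1 ≤ m → m ≤ n →
      RoundsMMLe n m k (F i) (C * k)) ∧
    -- `k ≥ n`, `m ≥ n`: `O(km/n)` rounds
    (∃ C : ℝ, ∀ (i : ι) (n m k : ℕ), Nat.card (F i) ≤ p.eval n → 1 ≤ n → n ≤ k →
      n ≤ m →
      RoundsMMLe n m k (F i) (C * ((k : ℝ) * m / n))) ∧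
    -- square matrices, `1 ≤ k < n`: `O(k^{2/ω} n^{1-2/ω})` rounds, up to `o(1)` in the exponent
    (∀ ε : ℝ, 0 < ε → ∃ C : ℝ, ∀ (i : ι) (n k : ℕ), Nat.card (F i) ≤ p.eval n → 1 ≤ k → k < n →
      RoundsMMLe n n k (F i)
        (C * ((k : ℝ) ^ (2 / matMulExponent F 1) * (n : ℝ) ^ (1 - 2 / matMulExponent F 1) *
          ((n : ℝ) / k) ^ ε))) ∧
    -- square matrices, `k ≥ n`: `O(k)` rounds
    (∃ C : ℝ, ∀ (i : ι) (n k : ℕ), Nat.card (F i) ≤ p.eval n → 1 ≤ n → n ≤ k →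
      RoundsMMLe n n k (F i) (C * k)) := by
  refine ⟨?_, ?_, ?_, ?_, ?_, ?_, ?_, ?_⟩
  · obtain ⟨K, -, h⟩ := exists_rounds_le_of_inner_le_sqrt p
    exact ⟨K, fun i n m k hF hk hkn hm => h (F i) n m k hF hk hkn hm⟩
  · exact fun n m k hk hkn h1 h2 => existsUnique_isBalancedExponent F hk hkn h1 h2
  · exact fun ε hε => exists_rounds_le_of_isBalancedExponent F p hε
  · obtain ⟨K, hK, h⟩ := exists_rounds_le_of_vertex_algorithm p
    refine ⟨2 * K, fun i n m k hF hk hkn hm => (h (F i) n m k hF hk hkn).mono ?_⟩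
    have hk0 : (0 : ℝ) < k := by exact_mod_cast hk
    have hn0 : (0 : ℝ) < n := by exact_mod_cast hk.trans hkn
    have hle : (n : ℝ) ≤ k * m / n := by
      rw [le_div_iff₀ hn0]
      rw [div_le_iff₀ hk0] at hm
      linarith
    calc K * (n + k * m / n) ≤ K * (k * m / n + k * m / n) := by gcongr
      _ = 2 * K * (k * m / n) := by ring
  · obtain ⟨K, hK, h⟩ := exists_rounds_le_of_le_instances p
    refine ⟨2 * K, fun i n m k hF hn hnk _ hmn => (h (F i) n m k hF hn hnk).mono ?_⟩
    have hn0 : (0 : ℝ) < n := by exact_mod_cast hn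
    have hle : (k : ℝ) * m / n ≤ k := by
      rw [div_le_iff₀ hn0]
      gcongr
    calc K * (k + k * m / n) ≤ K * (k + k) := by gcongr
      _ = 2 * K * k := by ring
  · obtain ⟨K, hK, h⟩ := exists_rounds_le_of_le_instances p
    refine ⟨2 * K, fun i n m k hF hn hnk hnm => (h (F i) n m k hF hn hnk).mono ?_⟩
    have hn0 : (0 : ℝ) < n := by exact_mod_cast hn
    have hle : (k : ℝ) ≤ k * m / n := by
      rw [le_div_iff₀ hn0]
      gcongr
    calc K * (k + k * m / n) ≤ K * (k * m / n + k * m / n) := by gcongr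
      _ = 2 * K * (k * m / n) := by ring
  · intro ε hε
    obtain ⟨C, hC⟩ := exists_rounds_le_of_isBalancedExponent F p hε
    refine ⟨C, fun i n k hF hk hkn => ?_⟩
    have hk0 : (0 : ℝ) < k := by exact_mod_cast hk
    have hkn' : (k : ℝ) < n := by exact_mod_cast hkn
    have hn1 : (1 : ℝ) < n := by exact_mod_cast (by omega : 1 < n)
    -- For `m = n` the coefficient of `ω(γ)` vanishes, so `γ = 1` solves the equation.
    refine hC i n n k hF hk hkn.le ?_ ?_ 1 ⟨zero_le_one, ?_⟩
    · rw [Real.sqrt_le_left (by linarith), sq]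
      gcongr
    · rw [lt_div_iff₀ hk0, sq]
      gcongr
    · rw [div_self (Real.log_pos hn1).ne']
      ring
  · obtain ⟨K, hK, h⟩ := exists_rounds_le_of_le_instances p
    refine ⟨2 * K, fun i n k hF hn hnk => (h (F i) n n k hF hn hnk).mono ?_⟩
    have hn0 : (0 : ℝ) < n := by exact_mod_cast hn
    rw [mul_div_cancel_right₀ _ hn0.ne']
    exact le_of_eq (by ring)
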